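/- Let $S$ be a set and let $\mathcal S\subset\mathcal P(S)$ be a $\delta$-ring: $\emptyset\in\mathcal S$, $\mathcal S$ is closed under finite unions, differences and countable intersections, and there are $S_1,S_2,\dots\in\mathcal S$ with $\bigcup_n S_n=S$. Let $\sigma(\mathcal S)$ be the $\sigma$-algebra on $S$ generated by $\mathcal S$. Let $M=(M(A))_{A\in\mathcal S}$ be an infinitely divisible (i.d.) independently scattered random measure (ISRM) on $\mathcal S$ with values in $\mathbb R^m$. That is, the $M(A)$ are $\mathbb R^m$-valued random vectors on one probability space such that: - for disjoint $A_1,\dots,A_k\in\mathcal S$ the vectors $M(A_1),\dots,M(A_k)$ are independent; - for every sequence of disjoint sets $A_n\in\mathcal S$ with $\bigcup_n A_n\in\mathcal S$ we have $M(\bigcup_n A_n)=\sum_{n=1}^\infty M(A_n)$ almost surely; - for every $A\in\mathcal S$ and every $n\ge 1$ the law of $M(A)$ is the $n$-fold convolution of some probability measure on $\mathbb R^m$. Then for every $A\in\mathcal S$ there is a unique triplet $[\gamma_A,Q_A,\phi_A]$, consisting of a vector $\gamma_A\in\mathbb R^m$, a symmetric positive semi-definite $m\times m$ matrix $Q_A$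 and a Borel measure $\phi_A$ on $\mathbb R^m$ with $\phi_A(\{0\})=0$ and $\int\min\{1,\|x\|^2\}\,\phi_A(dx)<\infty$, such that for all $t\in\mathbb R^m$ $$\mathbb E\,e^{i\langle t,M(A)\rangle}=\exp\Big(i\langle\gamma_A,t\rangle-\tfrac12\langle Q_At,t\rangle+\int_{\mathbb R^m}\Big(e^{i\langle t,x\rangle}-1-\frac{i\langle t,x\rangle}{1+\|x\|^2}\Big)\phi_A(dx)\Big).$$ For $A\in\mathcal S$ put $$|\gamma|_A=\sup\Big\{\sum_{j=1}^n\|\gamma_{A_j}\| : n\in\mathbb N,\ A_1,\dots,A_n\in\mathcal S\text{ disjoint},\ A_j\subset A\Big\}.$$ There is exactly one measure $\lambda_M$ on $\sigma(\mathcal S)$, the control measure of $M$, such that $$\lambda_M(A)=|\gamma|_A+\operatorname{tr}(Q_A)+\int_{\mathbb R^m}\min\{1,\|x\|^2\}\,\phi_A(dx)\qquad\text{for all }A\in\mathcal S.$$ It is finite on $\mathcal S$ and $\sigma$-finite. Furthermore, for every sequence $(A_n)\subset\mathcal S$: (i) If $\lambda_M(A_n)\to0$, then $M(A_n)\to0$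 in probability. (ii) If $M(A_n')\to0$ in probability for every sequence $(A_n')\subset\mathcal S$ with $A_n'\subset A_n$ for all $n$, then $\lambda_M(A_n)\to0$. -/

import Mathlib

open MeasureTheory ProbabilityTheory Filter Topology
open scoped ENNReal

noncomputable section

/-- `ℝ^m` with the Euclidean norm and inner product. -/
abbrev RVec (m : ℕ) : Type := EuclideanSpace ℝ (Fin m)

/-- A `δ`-ring on `S`: a ring of subsets of `S` that is closed under countable intersections and
contains a sequence whose union is `S`. -/
structure IsDeltaRing {S : Type*} (𝒮 : Set (Set S)) : Prop extends IsSetRing 𝒮 where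
  iInter_mem : ∀ A : ℕ → Set S, (∀ n, A n ∈ 𝒮) → ⋂ n, A n ∈ 𝒮
  exists_cover : ∃ A : ℕ → Set S, (∀ n, A n ∈ 𝒮) ∧ ⋃ n, A n = Set.univ

/-- The `n`-fold convolution `ν ∗ ⋯ ∗ ν` (the point mass at `0` for `n = 0`). -/
def convPower {m : ℕ} (ν : Measure (RVec m)) : ℕ → Measure (RVec m)
  | 0 => Measure.dirac 0
  | n + 1 => (convPower ν n).conv ν

/-- `μ` is infinitely divisible: for every `n ≥ 1` it is the `n`-fold convolution of some
probability measure. -/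
def IsInfDivisible {m : ℕ} (μ : Measure (RVec m)) : Prop :=
  ∀ n : ℕ, 1 ≤ n → ∃ ν : Measure (RVec m), IsProbabilityMeasure ν ∧ convPower ν n = μ

/-- The integral `∫ min {1, ‖x‖²} φ(dx) ∈ [0, ∞]`. -/
def minSqIntegral {m : ℕ} (φ : Measure (RVec m)) : ℝ≥0∞ :=
  ∫⁻ x, ENNReal.ofReal (min 1 (‖x‖ ^ 2)) ∂φ

/-- A Lévy measure on `ℝ^m`. -/
structure IsLevyMeasure {m : ℕ} (φ : Measure (RVec m)) : Prop where
  measure_zero : φ {0} = 0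
  minSqIntegral_lt_top : minSqIntegral φ < ∞

/-- The function
`ψ(t) = i⟨γ, t⟩ - ⟨Q t, t⟩ / 2 + ∫ (exp(i⟨t, x⟩) - 1 - i⟨t, x⟩ / (1 + ‖x‖²)) φ(dx)`. -/
def levyExponent {m : ℕ} (γ : RVec m) (Q : Matrix (Fin m) (Fin m) ℝ) (φ : Measure (RVec m))
    (t : RVec m) : ℂ :=
  Complex.I * ((inner ℝ γ t : ℝ) : ℂ)
    - (1 / 2 : ℂ) * ((inner ℝ (Matrix.toEuclideanLin Q t) t : ℝ) : ℂ)
    + ∫ x : RVec m, (Complex.exp (Complex.I * ((inner ℝ t x : ℝ) : ℂ)) - 1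
        - Complex.I * ((inner ℝ t x : ℝ) : ℂ) / (1 + (‖x‖ : ℂ) ^ 2)) ∂φ

/-- `μ ∼ [γ, Q, φ]`: the matrix `Q` is symmetric and positive semi-definite, `φ` is a Lévy
measure, and the characteristic function of `μ` is the exponential of the exponent above. -/
structure HasLevyTriplet {m : ℕ} (μ : Measure (RVec m)) (γ : RVec m)
    (Q : Matrix (Fin m) (Fin m) ℝ) (φ : Measure (RVec m)) : Prop where
  posSemidef : Q.PosSemidef
  isLevyMeasure : IsLevyMeasure φ
  charFun_eq : ∀ t : RVec m, charFun μ t = Complex.exp (levyExponent γ Q φ t)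

/-- `M` (of which only the values on `𝒮` matter) is an independently scattered random measure on
`𝒮` with values in `ℝ^m`. The series converges almost surely in the order of its terms; almost
sure unconditional convergence would be a strictly stronger requirement. -/
structure IsISRM {S Ω : Type*} [MeasurableSpace Ω] {m : ℕ} (P : Measure Ω) (𝒮 : Set (Set S))
    (M : Set S → Ω → RVec m) : Prop where
  measurable : ∀ A ∈ 𝒮, Measurable (M A)
  indep : ∀ (k : ℕ) (A : Fin k → Set S), (∀ i, A i ∈ 𝒮) → Pairwise (Function.onFun Disjoint A) →
    iIndepFun (fun i => M (A i)) P
  sigma_additive : ∀ A : ℕ → Set S, (∀ n, A n ∈ 𝒮) → Pairwise (Function.onFun Disjoint A) →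
    ⋃ n, A n ∈ 𝒮 →
    ∀ᵐ ω ∂P, Tendsto (fun n => ∑ i ∈ Finset.range n, M (A i) ω) atTop (𝓝 (M (⋃ n, A n) ω))

/-- The total variation `|T|(A)` of a set function `T` on `𝒮`: the supremum of `∑ ‖T (B j)‖` over
the finite families of disjoint sets `B j ∈ 𝒮` with `B j ⊆ A`. -/
def totalVariation {S : Type*} {m : ℕ} (𝒮 : Set (Set S)) (T : Set S → RVec m) (A : Set S) :
    ℝ≥0∞ :=
  ⨆ (n : ℕ) (B : Fin n → Set S) (_ : ∀ j, B j ∈ 𝒮 ∧ B j ⊆ A)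
    (_ : Pairwise (Function.onFun Disjoint B)), ∑ j, ‖T (B j)‖ₑ

/-- The quantity `|γ|_A + tr(Q_A) + ∫ min {1, ‖x‖²} φ_A(dx)`. The trace of a positive
semi-definite matrix is non-negative, so `ENNReal.ofReal` does not truncate it. -/
def controlValue {S : Type*} {m : ℕ} (𝒮 : Set (Set S)) (γ : Set S → RVec m)
    (Q : Set S → Matrix (Fin m) (Fin m) ℝ) (φ : Set S → Measure (RVec m)) (A : Set S) : ℝ≥0∞ :=
  totalVariation 𝒮 γ A + ENNReal.ofReal (Q A).trace + minSqIntegral (φ A)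

end

/-! The control value is finite, finitely additive and continuous at `∅` on `𝒮`, and such a set
function extends uniquely to a `σ`-finite measure on the generated `σ`-algebra
(`IsContinuousCharge.exists_measure`). Additivity comes from uniqueness of the triplet
(`levyTriplet_unique`): over disjoint sets the characteristic functions multiply, so the triplets
add. For continuity, if `s n` decreases to `∅` then `M (s n)` is the tail of an almost surely
convergent series, hence tends to `0` in probability, and this forces the triplets to vanish in the
limit.

The probabilistic core is that infinitely divisible laws converge to `δ₀` exactly when their drifts
`γ` and the quantities `tr Q + ∫ min {1, ‖x‖²} dφ` tend to `0`. The modulus of the characteristic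
function does not see the drift and controls the second quantity (`HasLevyTriplet.spread_le`); what
is left of the characteristic function is `exp(i⟨γ, t⟩)`, which controls the drift. Since the
control value contains the variation of `γ` and not only its norm, (ii) needs subsets: in each
coordinate some subset of `A` carries a fixed fraction of the variation over `A`
(`IsContinuousCharge.exists_totalVariation_le`).

Existence of the triplet (`IsInfDivisible.exists_hasLevyTriplet`) goes through compound Poisson
approximation. If `ν` is an `n`-th convolution root of `μ`, then `n (charFun ν - 1)` is an exponent
with jump measure `n ν`. Near the origin it is bounded uniformly in `n`, which makes the jump
measures tight away from `0`, and a limit along an ultrafilter is a Lévy–Khintchine exponent of `μ`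
(`exists_tendsto_levyExponent`). -/

noncomputable section

/-! ### The Lévy–Khintchine kernel and exponent: bounds, integrability, continuity. -/

/-- The integrand of the Lévy–Khintchine formula. -/
def levyKernel {m : ℕ} (t x : RVec m) : ℂ :=
  Complex.exp (Complex.I * ((inner ℝ t x : ℝ) : ℂ)) - 1
    - Complex.I * ((inner ℝ t x : ℝ) : ℂ) / (1 + (‖x‖ : ℂ) ^ 2)

/-- The weight `min {1, ‖x‖²}`. -/
def minSq {m : ℕ} (x : RVec m) : ℝ := min 1 (‖x‖ ^ 2)

section Kernel

variable {m : ℕ}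

lemma minSq_nonneg (x : RVec m) : 0 ≤ minSq x := le_min zero_le_one (sq_nonneg _)

lemma minSq_le_one (x : RVec m) : minSq x ≤ 1 := min_le_left _ _

lemma minSq_le_sq (x : RVec m) : minSq x ≤ ‖x‖ ^ 2 := min_le_right _ _

lemma continuous_minSq : Continuous (minSq : RVec m → ℝ) := by
  unfold minSq; fun_prop

lemma minSq_of_norm_le_one {x : RVec m} (hx : ‖x‖ ≤ 1) : minSq x = ‖x‖ ^ 2 :=
  min_eq_right (by nlinarith [norm_nonneg x])

lemma minSq_of_one_le_norm {x : RVec m} (hx : 1 ≤ ‖x‖) : minSq x = 1 :=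
  min_eq_left (by nlinarith [norm_nonneg x])

lemma minSq_pos {x : RVec m} (hx : x ≠ 0) : 0 < minSq x :=
  lt_min one_pos (by have := norm_pos_iff.2 hx; positivity)

lemma abs_inner_le_mul_norm {R : ℝ} {t : RVec m} (ht : ‖t‖ ≤ R) (x : RVec m) :
    |(inner ℝ t x : ℝ)| ≤ R * ‖x‖ :=
  (abs_real_inner_le_norm t x).trans (by gcongr)

lemma norm_exp_I_mul_sub_le (u : ℝ) :
    ‖Complex.exp (Complex.I * (u : ℂ)) - 1 - Complex.I * (u : ℂ)‖ ≤ u ^ 2 * Real.exp |u| := by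
  have h := Complex.norm_exp_sub_sum_le_norm_mul_exp (Complex.I * (u : ℂ)) 2
  simpa [Finset.sum_range_succ, sub_sub] using h

lemma norm_exp_I_mul_sub_one_le_two (u : ℝ) : ‖Complex.exp (Complex.I * (u : ℂ)) - 1‖ ≤ 2 := by
  refine (norm_sub_le _ _).trans ?_
  rw [mul_comm, Complex.norm_exp_ofReal_mul_I]; norm_num

/-- The constant in the bound of `levyKernel t` by `minSq` for `‖t‖ ≤ R`. -/
def kernelBound (R : ℝ) : ℝ := 2 + R + R ^ 2 * Real.exp R

/-- For `‖x‖ ≤ 1` the second-order Taylor remainder of the exponential and the error `u‖x‖²/(1 +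
‖x‖²)` of the compensator, with `u = ⟨t, x⟩`, are both `O(‖x‖²)`; for `‖x‖ ≥ 1` all terms are
bounded. -/
lemma norm_levyKernel_le {R : ℝ} {t : RVec m} (ht : ‖t‖ ≤ R) (x : RVec m) :
    ‖levyKernel t x‖ ≤ kernelBound R * minSq x := by
  have hR : 0 ≤ R := (norm_nonneg t).trans ht
  have hu := abs_inner_le_mul_norm ht x
  set u : ℝ := inner ℝ t x with hu_def
  have hx0 := norm_nonneg x
  have hden : (1 + (‖x‖ : ℂ) ^ 2) = ((1 + ‖x‖ ^ 2 : ℝ) : ℂ) := by push_cast; ring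
  have hpos : 0 < 1 + ‖x‖ ^ 2 := by positivity
  have hE : 0 ≤ R ^ 2 * Real.exp R := by positivity
  rcases le_total ‖x‖ 1 with hx | hx
  · rw [minSq_of_norm_le_one hx]
    have h1 : levyKernel t x = (Complex.exp (Complex.I * (u : ℂ)) - 1 - Complex.I * (u : ℂ))
        + Complex.I * ((u * (‖x‖ ^ 2 / (1 + ‖x‖ ^ 2)) : ℝ) : ℂ) := by
      unfold levyKernel
      rw [hden, ← hu_def]
      have : ((1 + ‖x‖ ^ 2 : ℝ) : ℂ) ≠ 0 := by exact_mod_cast hpos.ne'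
      push_cast at this ⊢
      field_simp
      ring
    have huR : |u| ≤ R := hu.trans (by nlinarith)
    have h2 : u ^ 2 * Real.exp |u| ≤ (R * ‖x‖) ^ 2 * Real.exp R := by
      have : u ^ 2 ≤ (R * ‖x‖) ^ 2 := by rw [← sq_abs]; gcongr
      gcongr
    have h3 : ‖Complex.I * ((u * (‖x‖ ^ 2 / (1 + ‖x‖ ^ 2)) : ℝ) : ℂ)‖ ≤ R * ‖x‖ ^ 2 := by
      rw [norm_mul, Complex.norm_I, one_mul, Complex.norm_real, Real.norm_eq_abs, abs_mul,
        abs_of_nonneg (by positivity : 0 ≤ ‖x‖ ^ 2 / (1 + ‖x‖ ^ 2))]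
      gcongr
      exact div_le_self (by positivity) (by nlinarith)
    rw [h1]
    refine (norm_add_le _ _).trans ((add_le_add ((norm_exp_I_mul_sub_le u).trans h2) h3).trans ?_)
    unfold kernelBound
    nlinarith [sq_nonneg ‖x‖]
  · rw [minSq_of_one_le_norm hx, mul_one]
    have h3 : ‖Complex.I * (u : ℂ) / (1 + (‖x‖ : ℂ) ^ 2)‖ ≤ R := by
      rw [hden, norm_div, norm_mul, Complex.norm_I, one_mul, Complex.norm_real, Complex.norm_real,
        Real.norm_eq_abs, Real.norm_eq_abs, abs_of_pos hpos, div_le_iff₀ hpos]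
      exact hu.trans (mul_le_mul_of_nonneg_left (by nlinarith) hR)
    refine (norm_sub_le _ _).trans ?_
    have := norm_exp_I_mul_sub_one_le_two u
    unfold kernelBound
    linarith

lemma continuous_levyKernel_left (x : RVec m) : Continuous fun t : RVec m => levyKernel t x := by
  unfold levyKernel; fun_prop

lemma one_add_norm_sq_ne_zero (x : RVec m) : (1 + (‖x‖ : ℂ) ^ 2) ≠ 0 := by
  have : (0 : ℝ) < 1 + ‖x‖ ^ 2 := by positivity
  exact_mod_cast this.ne'

lemma continuous_levyKernel_right (t : RVec m) : Continuous fun x : RVec m => levyKernel t x := by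
  unfold levyKernel
  refine Continuous.sub (by fun_prop) (Continuous.div (by fun_prop) (by fun_prop)
    one_add_norm_sq_ne_zero)

lemma levyKernel_re (t x : RVec m) : (levyKernel t x).re = Real.cos (inner ℝ t x) - 1 := by
  have hden : (1 + (‖x‖ : ℂ) ^ 2) = ((1 + ‖x‖ ^ 2 : ℝ) : ℂ) := by push_cast; ring
  unfold levyKernel
  rw [hden, mul_comm, Complex.sub_re, Complex.sub_re, Complex.exp_ofReal_mul_I_re,
    Complex.div_ofReal_re]
  simp

/-- The compensator is linear in `t`, so a second difference removes it and leaves a character times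
the non-negative function `1 - cos⟨s, x⟩`. This turns the exponent into the characteristic function
of a finite measure. -/
lemma levyKernel_second_difference (s t x : RVec m) :
    levyKernel t x - (1 / 2 : ℂ) * (levyKernel (t + s) x + levyKernel (t - s) x)
      = Complex.exp ((inner ℝ x t : ℝ) * Complex.I) * ((1 - Real.cos (inner ℝ s x) : ℝ) : ℂ) := by
  have h1 : Complex.exp (Complex.I * (((inner ℝ t x : ℝ) + (inner ℝ s x : ℝ) : ℝ) : ℂ))
      = Complex.exp (Complex.I * (inner ℝ t x : ℝ)) * Complex.exp ((inner ℝ s x : ℝ) * Complex.I) := by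
    rw [← Complex.exp_add]; push_cast; ring_nf
  have h2 : Complex.exp (Complex.I * (((inner ℝ t x : ℝ) - (inner ℝ s x : ℝ) : ℝ) : ℂ))
      = Complex.exp (Complex.I * (inner ℝ t x : ℝ))
        * Complex.exp (-(inner ℝ s x : ℝ) * Complex.I) := by
    rw [← Complex.exp_add]; push_cast; ring_nf
  unfold levyKernel
  rw [inner_add_left, inner_sub_left, h1, h2, real_inner_comm t x,
    mul_comm _ Complex.I]
  push_cast [Complex.cos]
  ring_nf

lemma minSqIntegral_eq (φ : Measure (RVec m)) :
    minSqIntegral φ = ∫⁻ x, ENNReal.ofReal (minSq x) ∂φ := rfl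

variable {φ : Measure (RVec m)}

lemma IsLevyMeasure.integrable_minSq (hφ : IsLevyMeasure φ) : Integrable (minSq (m := m)) φ := by
  refine ⟨continuous_minSq.aestronglyMeasurable, ?_⟩
  rw [hasFiniteIntegral_iff_ofReal (ae_of_all _ minSq_nonneg)]
  exact hφ.minSqIntegral_lt_top

lemma IsLevyMeasure.ofReal_integral_minSq (hφ : IsLevyMeasure φ) :
    ENNReal.ofReal (∫ x, minSq x ∂φ) = minSqIntegral φ :=
  ofReal_integral_eq_lintegral_ofReal hφ.integrable_minSq (ae_of_all _ minSq_nonneg)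

lemma IsLevyMeasure.integrable_levyKernel (hφ : IsLevyMeasure φ) (t : RVec m) :
    Integrable (levyKernel t) φ :=
  (hφ.integrable_minSq.const_mul (kernelBound ‖t‖)).mono'
    (continuous_levyKernel_right t).aestronglyMeasurable
    (ae_of_all _ fun x => norm_levyKernel_le le_rfl x)

lemma IsLevyMeasure.norm_integral_levyKernel_le (hφ : IsLevyMeasure φ) (t : RVec m) :
    ‖∫ x, levyKernel t x ∂φ‖ ≤ kernelBound ‖t‖ * ∫ x, minSq x ∂φ := by
  rw [← integral_const_mul]
  exact norm_integral_le_of_norm_le (hφ.integrable_minSq.const_mul _)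
    (ae_of_all _ fun x => norm_levyKernel_le le_rfl x)

lemma IsLevyMeasure.continuous_integral_levyKernel (hφ : IsLevyMeasure φ) :
    Continuous fun t : RVec m => ∫ x, levyKernel t x ∂φ := by
  rw [continuous_iff_continuousAt]
  intro t
  refine continuousAt_of_dominated (bound := fun x => kernelBound (‖t‖ + 1) * minSq x)
    (Eventually.of_forall fun s => (continuous_levyKernel_right s).aestronglyMeasurable) ?_
    (hφ.integrable_minSq.const_mul _)
    (ae_of_all _ fun x => (continuous_levyKernel_left x).continuousAt)
  filter_upwards [Metric.ball_mem_nhds t one_pos] with s hs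
  refine ae_of_all _ fun x => norm_levyKernel_le ?_ x
  have : ‖s - t‖ < 1 := by simpa [dist_eq_norm] using hs
  have := norm_le_norm_add_norm_sub' s t
  rw [norm_sub_rev] at this
  linarith [norm_sub_rev s t]

lemma levyExponent_eq (γ : RVec m) (Q : Matrix (Fin m) (Fin m) ℝ) (φ : Measure (RVec m))
    (t : RVec m) :
    levyExponent γ Q φ t = Complex.I * ((inner ℝ γ t : ℝ) : ℂ)
      - (1 / 2 : ℂ) * ((inner ℝ (Matrix.toEuclideanLin Q t) t : ℝ) : ℂ)
      + ∫ x, levyKernel t x ∂φ := rfl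

lemma IsLevyMeasure.continuous_levyExponent (hφ : IsLevyMeasure φ) (γ : RVec m)
    (Q : Matrix (Fin m) (Fin m) ℝ) : Continuous (levyExponent γ Q φ) := by
  have h : Continuous fun t : RVec m => Matrix.toEuclideanLin Q t :=
    LinearMap.continuous_of_finiteDimensional _
  have h' : Continuous fun t : RVec m => inner ℝ (Matrix.toEuclideanLin Q t) t :=
    h.inner continuous_id
  have := hφ.continuous_integral_levyKernel
  simp only [funext (levyExponent_eq γ Q φ)]
  fun_prop

lemma levyExponent_zero (γ : RVec m) (Q : Matrix (Fin m) (Fin m) ℝ) :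
    levyExponent γ Q φ 0 = 0 := by
  simp [levyExponent_eq, levyKernel]

lemma IsLevyMeasure.levyExponent_re (hφ : IsLevyMeasure φ) (γ : RVec m)
    (Q : Matrix (Fin m) (Fin m) ℝ) (t : RVec m) :
    (levyExponent γ Q φ t).re = -(1 / 2) * inner ℝ (Matrix.toEuclideanLin Q t) t
      - ∫ x, (1 - Real.cos (inner ℝ t x)) ∂φ := by
  have h : (∫ x, levyKernel t x ∂φ).re = - ∫ x, (1 - Real.cos (inner ℝ t x)) ∂φ := by
    rw [← integral_neg]
    have := integral_re (hφ.integrable_levyKernel t)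
    simp only [RCLike.re_eq_complex_re] at this
    rw [← this]
    simp [levyKernel_re]
  rw [levyExponent_eq, Complex.add_re, h]
  simp [Complex.sub_re, Complex.mul_re]
  ring

lemma IsLevyMeasure.integrable_one_sub_cos (hφ : IsLevyMeasure φ) (t : RVec m) :
    Integrable (fun x => 1 - Real.cos (inner ℝ t x)) φ := by
  have := (hφ.integrable_levyKernel t).re.neg
  refine this.congr (ae_of_all _ fun x => ?_)
  simp [levyKernel_re]

/-- `minSq` is integrable and positive off the origin, so its superlevel sets have finite measure
and exhaust everything but the null point `0`. The Fubini step in `lintegral_min_one_sq_le` needs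
this. -/
lemma IsLevyMeasure.sigmaFinite (hφ : IsLevyMeasure φ) : SigmaFinite φ := by
  refine ⟨⟨⟨fun n => {x | 1 / ((n : ℝ) + 1) ≤ minSq x} ∪ {0}, fun _ => trivial, fun n => ?_, ?_⟩⟩⟩
  · refine (measure_union_le _ _).trans_lt ?_
    rw [hφ.measure_zero, add_zero]
    have h := mul_meas_ge_le_lintegral₀ (μ := φ) (f := fun x => ENNReal.ofReal (minSq x))
      continuous_minSq.measurable.ennreal_ofReal.aemeasurable (ENNReal.ofReal (1 / ((n : ℝ) + 1)))
    have hp : (0 : ℝ) < 1 / ((n : ℝ) + 1) := by positivity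
    have h2 : φ {x | ENNReal.ofReal (1 / ((n : ℝ) + 1)) ≤ ENNReal.ofReal (minSq x)} < ∞ := by
      by_contra hcon
      rw [not_lt, top_le_iff] at hcon
      rw [hcon, ENNReal.mul_top (by simpa using hp)] at h
      exact absurd hφ.minSqIntegral_lt_top (not_lt.2 h)
    refine (measure_mono fun x hx => ?_).trans_lt h2
    exact ENNReal.ofReal_le_ofReal hx
  · refine Set.eq_univ_of_forall fun x => ?_
    by_cases hx : x = 0
    · exact Set.mem_iUnion.2 ⟨0, Or.inr hx⟩
    · obtain ⟨n, hn⟩ := exists_nat_one_div_lt (minSq_pos hx)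
      exact Set.mem_iUnion.2 ⟨n, Or.inl hn.le⟩

end Kernel

/-! ### Truncation inequality: mass away from the origin against `1 - cos`. -/

section Truncation

variable {m : ℕ}

/-- For `|a| ≤ 2 < π` the bound `1 - cos y ≥ 2y²/π² ≥ y²/5` makes the integral at least `a²/15`; for
`|a| ≥ 2` the integral is `1 - sin a / a ≥ 1/2`. The factor `20` covers both cases. -/
lemma min_one_sq_le_integral_one_sub_cos (a : ℝ) :
    min 1 (a ^ 2) ≤ 20 * ∫ s in (0 : ℝ)..1, (1 - Real.cos (s * a)) := by
  rcases le_total |a| 2 with ha | ha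
  · have hpi := Real.pi_gt_three
    have h1 : ∀ s ∈ Set.Icc (0 : ℝ) 1, (1 / 5) * (s * a) ^ 2 ≤ 1 - Real.cos (s * a) := by
      intro s hs
      have h := Real.cos_le_one_sub_mul_cos_sq (x := s * a) (by
        rw [abs_mul, abs_of_nonneg hs.1]
        nlinarith [hs.2, abs_nonneg a])
      have h2 : (1 / 5 : ℝ) ≤ 2 / Real.pi ^ 2 := by
        rw [div_le_div_iff₀ (by norm_num) (by positivity)]
        nlinarith [Real.pi_lt_d2]
      nlinarith [sq_nonneg (s * a)]
    have h2 : ∫ s in (0 : ℝ)..1, (1 / 5) * (s * a) ^ 2 ≤ ∫ s in (0 : ℝ)..1, (1 - Real.cos (s * a)) :=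
      intervalIntegral.integral_mono_on zero_le_one
        (Continuous.intervalIntegrable (by fun_prop) _ _)
        (Continuous.intervalIntegrable (by fun_prop) _ _) h1
    have h3 : ∫ s in (0 : ℝ)..1, (1 / 5) * (s * a) ^ 2 = a ^ 2 / 15 := by
      simp only [mul_pow, intervalIntegral.integral_const_mul, intervalIntegral.integral_mul_const,
        integral_pow]
      norm_num
      ring
    rw [h3] at h2
    refine (min_le_right _ _).trans ?_
    nlinarith [sq_nonneg a]
  · have ha0 : a ≠ 0 := by rintro rfl; norm_num at ha
    have h1 : ∫ s in (0 : ℝ)..1, (1 - Real.cos (s * a)) = 1 - Real.sin a / a := by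
      rw [intervalIntegral.integral_sub (by simp) (Continuous.intervalIntegrable (by fun_prop) _ _),
        intervalIntegral.integral_comp_mul_right _ ha0]
      simp; ring
    rw [h1]
    have h2 := Real.sin_div_le_inv_abs a
    have h3 : |a|⁻¹ ≤ 1 / 2 := by rw [one_div]; exact inv_anti₀ two_pos ha
    refine (min_le_left _ _).trans ?_
    linarith

lemma min_one_sum_le {ι : Type*} (s : Finset ι) (f : ι → ℝ) (hf : ∀ i, 0 ≤ f i) :
    min 1 (∑ i ∈ s, f i) ≤ ∑ i ∈ s, min 1 (f i) := by
  by_cases h : ∃ i ∈ s, 1 ≤ f i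
  · obtain ⟨i, hi, h1⟩ := h
    calc min 1 (∑ i ∈ s, f i) ≤ 1 := min_le_left _ _
      _ = min 1 (f i) := (min_eq_left h1).symm
      _ ≤ _ := Finset.single_le_sum (f := fun i => min 1 (f i))
        (fun j _ => le_min zero_le_one (hf j)) hi
  · push Not at h
    refine (min_le_right _ _).trans (Finset.sum_le_sum fun i hi => ?_)
    rw [min_eq_right (h i hi).le]

/-- A truncation inequality: the mass that a measure puts away from the origin is controlled by
the integrals of `1 - cos ⟪t, x⟫` for small `t`. -/
lemma lintegral_min_one_sq_le (φ : Measure (RVec m)) [SFinite φ] {r : ℝ} (hr : 0 ≤ r) {K : ℝ≥0∞}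
    (hK : ∀ t : RVec m, ‖t‖ ≤ r → ∫⁻ x, ENNReal.ofReal (1 - Real.cos (inner ℝ t x)) ∂φ ≤ K) :
    ∫⁻ x, ENNReal.ofReal (min 1 ((r * ‖x‖) ^ 2)) ∂φ ≤ 20 * m * K := by
  -- Averaging the hypothesis over the segment `t = s r eᵢ`, `0 < s ≤ 1`, and exchanging the
  -- integrals treats one coordinate; the factor `m` comes from summing over coordinates.
  have hcoord : ∀ i : Fin m, ∫⁻ x, ENNReal.ofReal (min 1 ((r * x i) ^ 2)) ∂φ ≤ 20 * K := by
    intro i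
    have h1 : ∀ x : RVec m, ENNReal.ofReal (min 1 ((r * x i) ^ 2)) ≤
        20 * ∫⁻ s in Set.Ioc (0 : ℝ) 1, ENNReal.ofReal (1 - Real.cos (s * (r * x i))) := by
      intro x
      refine (ENNReal.ofReal_le_ofReal (min_one_sq_le_integral_one_sub_cos (r * x i))).trans ?_
      rw [ENNReal.ofReal_mul (by norm_num), intervalIntegral.integral_of_le zero_le_one,
        ofReal_integral_eq_lintegral_ofReal]
      · norm_num
      · exact (Continuous.integrableOn_Icc (by fun_prop)).mono_set Set.Ioc_subset_Icc_self
      · exact ae_of_all _ fun s => sub_nonneg.2 (Real.cos_le_one _)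
    have hmeas : Measurable (Function.uncurry fun (x : RVec m) (s : ℝ) =>
        ENNReal.ofReal (1 - Real.cos (s * (r * x i)))) := by
      apply Measurable.ennreal_ofReal
      apply Continuous.measurable
      fun_prop
    calc ∫⁻ x, ENNReal.ofReal (min 1 ((r * x i) ^ 2)) ∂φ
        ≤ ∫⁻ x, (20 * ∫⁻ s in Set.Ioc (0 : ℝ) 1,
            ENNReal.ofReal (1 - Real.cos (s * (r * x i)))) ∂φ := lintegral_mono h1
      _ = 20 * ∫⁻ x, (∫⁻ s in Set.Ioc (0 : ℝ) 1,
            ENNReal.ofReal (1 - Real.cos (s * (r * x i)))) ∂φ :=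
          lintegral_const_mul _ (hmeas.lintegral_prod_right')
      _ = 20 * ∫⁻ s in Set.Ioc (0 : ℝ) 1, (∫⁻ x,
            ENNReal.ofReal (1 - Real.cos (s * (r * x i))) ∂φ) := by
          rw [lintegral_lintegral_swap hmeas.aemeasurable]
      _ ≤ 20 * ∫⁻ s in Set.Ioc (0 : ℝ) 1, K := by
          gcongr 20 * ?_
          refine setLIntegral_mono measurable_const fun s hs => ?_
          refine le_trans (le_of_eq ?_) (hK ((s * r) • EuclideanSpace.single i 1) ?_)
          · refine lintegral_congr fun x => ?_
            rw [real_inner_smul_left, EuclideanSpace.inner_single_left]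
            simp [mul_assoc]
          · rw [norm_smul, PiLp.norm_single, Real.norm_eq_abs,
              abs_of_nonneg (mul_nonneg hs.1.le hr)]
            simpa using mul_le_of_le_one_left hr hs.2
      _ = 20 * K := by simp
  calc ∫⁻ x, ENNReal.ofReal (min 1 ((r * ‖x‖) ^ 2)) ∂φ
      ≤ ∫⁻ x, ∑ i : Fin m, ENNReal.ofReal (min 1 ((r * x i) ^ 2)) ∂φ := by
        refine lintegral_mono fun x => ?_
        rw [← ENNReal.ofReal_sum_of_nonneg fun i _ => le_min zero_le_one (sq_nonneg _)]
        refine ENNReal.ofReal_le_ofReal ?_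
        rw [mul_pow, EuclideanSpace.real_norm_sq_eq, Finset.mul_sum]
        simp only [← mul_pow]
        exact min_one_sum_le _ _ fun i => sq_nonneg _
    _ = ∑ i : Fin m, ∫⁻ x, ENNReal.ofReal (min 1 ((r * x i) ^ 2)) ∂φ :=
        lintegral_finsetSum _ fun i _ => by
          apply Measurable.ennreal_ofReal
          apply Continuous.measurable
          fun_prop
    _ ≤ ∑ _i : Fin m, 20 * K := Finset.sum_le_sum fun i _ => hcoord i
    _ = 20 * m * K := by simp; ring

end Truncation

/-! ### Uniqueness and additivity of the triplet. -/

section Uniqueness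

variable {m : ℕ}

/-- The values of `d` lie in `2πiℤ`, so `‖d‖` is `0` or at least `2π`; on a connected space a
continuous function cannot jump over the value `1`. This removes the ambiguity of the logarithm. -/
lemma eq_zero_of_exp_eq_one {E : Type*} [TopologicalSpace E] [PreconnectedSpace E] {d : E → ℂ}
    (hd : Continuous d) (hexp : ∀ t, Complex.exp (d t) = 1) {t₀ : E} (h0 : d t₀ = 0) (t : E) :
    d t = 0 := by
  by_contra hne
  have key : ∀ s, d s = 0 ∨ 2 * Real.pi ≤ ‖d s‖ := by
    intro s
    obtain ⟨n, hn⟩ := Complex.exp_eq_one_iff.1 (hexp s)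
    rcases eq_or_ne n 0 with rfl | hn0
    · left; simpa using hn
    · right
      have h1 : (1 : ℝ) ≤ |(n : ℝ)| := by exact_mod_cast Int.one_le_abs hn0
      rw [hn]
      simp only [norm_mul, Complex.norm_intCast, Complex.norm_I, Complex.norm_ofNat,
        Complex.norm_real, mul_one, Real.norm_eq_abs, abs_of_pos Real.pi_pos]
      nlinarith [Real.pi_pos]
  have hpi := Real.pi_gt_three
  obtain ⟨s, hs⟩ := mem_range_of_exists_le_of_exists_ge (c := (1 : ℝ)) (f := fun t => ‖d t‖)
    hd.norm ⟨t₀, by simp [h0]⟩ ⟨t, by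
      rcases key t with h | h
      · exact absurd h hne
      · linarith⟩
  simp only at hs
  rcases key s with h | h
  · simp [h] at hs
  · linarith

lemma levyExponent_eq_of_exp_eq {γ₁ γ₂ : RVec m} {Q₁ Q₂ : Matrix (Fin m) (Fin m) ℝ}
    {φ₁ φ₂ : Measure (RVec m)} (h₁ : IsLevyMeasure φ₁) (h₂ : IsLevyMeasure φ₂)
    (h : ∀ t, Complex.exp (levyExponent γ₁ Q₁ φ₁ t) = Complex.exp (levyExponent γ₂ Q₂ φ₂ t))
    (t : RVec m) : levyExponent γ₁ Q₁ φ₁ t = levyExponent γ₂ Q₂ φ₂ t := by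
  refine sub_eq_zero.1 (eq_zero_of_exp_eq_one (t₀ := 0)
    (d := fun t => levyExponent γ₁ Q₁ φ₁ t - levyExponent γ₂ Q₂ φ₂ t)
    ((h₁.continuous_levyExponent γ₁ Q₁).sub (h₂.continuous_levyExponent γ₂ Q₂)) (fun s => ?_) ?_ t)
  · rw [Complex.exp_sub, h s, div_self (Complex.exp_ne_zero _)]
  · simp [levyExponent_zero]

/-- The quadratic form of a matrix. -/
def quadForm (Q : Matrix (Fin m) (Fin m) ℝ) (t : RVec m) : ℝ :=
  inner ℝ (Matrix.toEuclideanLin Q t) t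

lemma quadForm_eq_sum (Q : Matrix (Fin m) (Fin m) ℝ) (t : RVec m) :
    quadForm Q t = ∑ i, ∑ j, Q i j * (t i * t j) := by
  simp only [quadForm, PiLp.inner_apply, Matrix.toLpLin_apply, Matrix.mulVec, dotProduct,
    RCLike.inner_apply, conj_trivial, Finset.mul_sum]
  exact Finset.sum_congr rfl fun i _ => Finset.sum_congr rfl fun j _ => by ring

lemma posSemidef_iff_quadForm {Q : Matrix (Fin m) (Fin m) ℝ} :
    Q.PosSemidef ↔ Q.IsHermitian ∧ ∀ t : RVec m, 0 ≤ quadForm Q t := by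
  rw [Matrix.posSemidef_iff_dotProduct_mulVec]
  refine and_congr_right fun _ => ⟨fun h t => ?_, fun h x => ?_⟩
  · have := h (WithLp.ofLp t)
    rw [quadForm_eq_sum]
    simp only [Matrix.mulVec, dotProduct, Finset.mul_sum, star_trivial] at this
    refine this.trans_eq ?_
    exact Finset.sum_congr rfl fun i _ => Finset.sum_congr rfl fun j _ => by ring
  · have := h (WithLp.toLp 2 x)
    rw [quadForm_eq_sum] at this
    simp only [Matrix.mulVec, dotProduct, Finset.mul_sum, star_trivial]
    refine this.trans_eq ?_
    exact Finset.sum_congr rfl fun i _ => Finset.sum_congr rfl fun j _ => by simp; ring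

lemma quadForm_second_difference (Q : Matrix (Fin m) (Fin m) ℝ) (t s : RVec m) :
    quadForm Q t - (1 / 2) * (quadForm Q (t + s) + quadForm Q (t - s)) = -quadForm Q s := by
  simp only [quadForm, map_add, map_sub, inner_add_left, inner_add_right, inner_sub_left,
    inner_sub_right]
  ring

lemma quadForm_single (Q : Matrix (Fin m) (Fin m) ℝ) (i : Fin m) :
    quadForm Q (EuclideanSpace.single i 1) = Q i i := by
  simp [quadForm_eq_sum]

lemma quadForm_single_add (Q : Matrix (Fin m) (Fin m) ℝ) (i j : Fin m) :
    quadForm Q (EuclideanSpace.single i 1 + EuclideanSpace.single j 1)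
      = Q i i + Q j j + (Q i j + Q j i) := by
  simp only [quadForm_eq_sum, PiLp.add_apply, PiLp.single_apply]
  simp [mul_add, Finset.sum_add_distrib]
  ring

lemma eq_of_quadForm_eq {Q₁ Q₂ : Matrix (Fin m) (Fin m) ℝ} (h₁ : Q₁.IsHermitian)
    (h₂ : Q₂.IsHermitian) (h : ∀ t, quadForm Q₁ t = quadForm Q₂ t) : Q₁ = Q₂ := by
  ext i j
  have hi := h (EuclideanSpace.single i 1)
  have hj := h (EuclideanSpace.single j 1)
  have hij := h (EuclideanSpace.single i 1 + EuclideanSpace.single j 1)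
  rw [quadForm_single, quadForm_single] at hi hj
  rw [quadForm_single_add, quadForm_single_add] at hij
  have s1 : Q₁ j i = Q₁ i j := by simpa using h₁.apply i j
  have s2 : Q₂ j i = Q₂ i j := by simpa using h₂.apply i j
  linarith

lemma levyExponent_second_difference {φ : Measure (RVec m)} (hφ : IsLevyMeasure φ) (γ : RVec m)
    (Q : Matrix (Fin m) (Fin m) ℝ) (s t : RVec m) :
    levyExponent γ Q φ t
        - (1 / 2 : ℂ) * (levyExponent γ Q φ (t + s) + levyExponent γ Q φ (t - s))
      = ((1 / 2 * quadForm Q s : ℝ) : ℂ)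
        + ∫ x, Complex.exp ((inner ℝ x t : ℝ) * Complex.I)
            * ((1 - Real.cos (inner ℝ s x) : ℝ) : ℂ) ∂φ := by
  have h1 : ∫ x, Complex.exp ((inner ℝ x t : ℝ) * Complex.I)
            * ((1 - Real.cos (inner ℝ s x) : ℝ) : ℂ) ∂φ
      = ∫ x, levyKernel t x ∂φ - (1 / 2 : ℂ) * (∫ x, levyKernel (t + s) x ∂φ
          + ∫ x, levyKernel (t - s) x ∂φ) := by
    have i1 := hφ.integrable_levyKernel t
    have i2 := hφ.integrable_levyKernel (t + s)
    have i3 := hφ.integrable_levyKernel (t - s)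
    have i4 : Integrable (fun x => (1 / 2 : ℂ) * (levyKernel (t + s) x + levyKernel (t - s) x)) φ :=
      (i2.add i3).const_mul _
    rw [← integral_add i2 i3, ← integral_const_mul, ← integral_sub i1 i4]
    exact integral_congr_ae (ae_of_all _ fun x => (levyKernel_second_difference s t x).symm)
  have h2 := quadForm_second_difference Q t s
  have h3 : quadForm Q s = -(quadForm Q t - (1 / 2) * (quadForm Q (t + s) + quadForm Q (t - s))) := by
    linarith
  rw [h1, h3]
  simp only [levyExponent_eq, inner_add_right, inner_sub_right, quadForm]
  push_cast
  ring

/-- The finite measure `(1 - cos ⟪s, x⟫) φ(dx) + ½ ⟪Q s, s⟫ δ₀`, whose characteristic function is a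
second difference of the exponent. -/
def secondDifferenceMeasure (Q : Matrix (Fin m) (Fin m) ℝ) (φ : Measure (RVec m)) (s : RVec m) :
    Measure (RVec m) :=
  φ.withDensity (fun x => ENNReal.ofReal (1 - Real.cos (inner ℝ s x)))
    + ENNReal.ofReal (1 / 2 * quadForm Q s) • Measure.dirac 0

lemma measurable_ofReal_one_sub_cos (s : RVec m) :
    Measurable fun x : RVec m => ENNReal.ofReal (1 - Real.cos (inner ℝ s x)) := by
  apply Measurable.ennreal_ofReal
  apply Continuous.measurable
  fun_prop

lemma IsLevyMeasure.isFiniteMeasure_withDensity_one_sub_cos {φ : Measure (RVec m)}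
    (hφ : IsLevyMeasure φ) (s : RVec m) :
    IsFiniteMeasure (φ.withDensity fun x => ENNReal.ofReal (1 - Real.cos (inner ℝ s x))) :=
  isFiniteMeasure_withDensity_ofReal (hφ.integrable_one_sub_cos s).2

lemma IsLevyMeasure.isFiniteMeasure_secondDifferenceMeasure {φ : Measure (RVec m)}
    (hφ : IsLevyMeasure φ) (Q : Matrix (Fin m) (Fin m) ℝ) (s : RVec m) :
    IsFiniteMeasure (secondDifferenceMeasure Q φ s) := by
  have := hφ.isFiniteMeasure_withDensity_one_sub_cos s
  have : IsFiniteMeasure (ENNReal.ofReal (1 / 2 * quadForm Q s) •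
      (Measure.dirac 0 : Measure (RVec m))) := Measure.smul_finite _ ENNReal.ofReal_ne_top
  unfold secondDifferenceMeasure
  infer_instance

lemma charFun_secondDifferenceMeasure {φ : Measure (RVec m)} (hφ : IsLevyMeasure φ) (γ : RVec m)
    {Q : Matrix (Fin m) (Fin m) ℝ} (hQ : Q.PosSemidef) (s t : RVec m) :
    charFun (secondDifferenceMeasure Q φ s) t = levyExponent γ Q φ t
      - (1 / 2 : ℂ) * (levyExponent γ Q φ (t + s) + levyExponent γ Q φ (t - s)) := by
  have := hφ.isFiniteMeasure_withDensity_one_sub_cos s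
  have hc : Continuous fun x : RVec m => Complex.exp ((inner ℝ x t : ℝ) * Complex.I) := by fun_prop
  have hb : ∀ x : RVec m, ‖Complex.exp ((inner ℝ x t : ℝ) * Complex.I)‖ ≤ 1 := fun x => by
    rw [Complex.norm_exp_ofReal_mul_I]
  have hq := (posSemidef_iff_quadForm.1 hQ).2 s
  rw [levyExponent_second_difference hφ, charFun_apply, secondDifferenceMeasure,
    integral_add_measure, integral_smul_measure, integral_dirac,
    integral_withDensity_eq_integral_toReal_smul (measurable_ofReal_one_sub_cos s)
      (ae_of_all _ fun _ => ENNReal.ofReal_lt_top)]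
  · rw [add_comm]
    congr 1
    · rw [ENNReal.toReal_ofReal (by positivity)]
      simp
    · refine integral_congr_ae (ae_of_all _ fun x => ?_)
      simp only
      rw [ENNReal.toReal_ofReal (sub_nonneg.2 (Real.cos_le_one _)), Complex.real_smul, mul_comm]
  · exact Integrable.of_bound hc.aestronglyMeasurable 1 (ae_of_all _ hb)
  · exact (integrable_dirac (by simp)).smul_measure ENNReal.ofReal_ne_top

/-- A single density `1 - cos⟨s, x⟩` vanishes on many hyperplanes. Summing over the frequencies `1`
and `√2` on each axis leaves only the zero `x = 0`, because `xᵢ` and `√2 xᵢ` both in `2πℤ` forces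
`xᵢ = 0`; the sum can then be inverted almost everywhere. -/
lemma eq_of_withDensity_one_sub_cos_eq {φ₁ φ₂ : Measure (RVec m)} (h₁ : φ₁ {0} = 0)
    (h₂ : φ₂ {0} = 0)
    (h : ∀ s : RVec m, φ₁.withDensity (fun x => ENNReal.ofReal (1 - Real.cos (inner ℝ s x)))
      = φ₂.withDensity (fun x => ENNReal.ofReal (1 - Real.cos (inner ℝ s x)))) : φ₁ = φ₂ := by
  classical
  let f : RVec m → ℝ≥0∞ := fun x => ∑ p : Fin m × Bool, ENNReal.ofReal
    (1 - Real.cos (inner ℝ ((if p.2 then (1 : ℝ) else √2) • EuclideanSpace.single p.1 (1 : ℝ)) x))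
  have hf : Measurable f := Finset.measurable_sum _ fun p _ => measurable_ofReal_one_sub_cos _
  have hfeq : φ₁.withDensity f = φ₂.withDensity f := by
    ext B hB
    simp only [withDensity_apply _ hB, f]
    rw [lintegral_finsetSum _ fun p _ => measurable_ofReal_one_sub_cos _,
      lintegral_finsetSum _ fun p _ => measurable_ofReal_one_sub_cos _]
    refine Finset.sum_congr rfl fun p _ => ?_
    rw [← withDensity_apply _ hB, ← withDensity_apply _ hB, h]
  have hpos : ∀ x : RVec m, x ≠ 0 → f x ≠ 0 := by
    intro x hx hfx
    rw [Finset.sum_eq_zero_iff] at hfx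
    apply hx
    ext i
    have hcos : ∀ b : Bool, Real.cos ((if b then (1 : ℝ) else √2) * x i) = 1 := by
      intro b
      have := hfx (i, b) (Finset.mem_univ _)
      rw [ENNReal.ofReal_eq_zero, real_inner_smul_left, EuclideanSpace.inner_single_left] at this
      simp only [map_one, one_mul] at this
      exact le_antisymm (Real.cos_le_one _) (by linarith)
    obtain ⟨a, ha⟩ := (Real.cos_eq_one_iff _).1 (hcos true)
    obtain ⟨b, hb⟩ := (Real.cos_eq_one_iff _).1 (hcos false)
    simp only [if_true, one_mul, Bool.false_eq_true, if_false] at ha hb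
    by_contra hxi
    simp only [PiLp.zero_apply] at hxi
    have hpi := Real.pi_pos
    have ha0 : (a : ℝ) ≠ 0 := by
      rintro h0
      rw [h0, zero_mul] at ha
      exact hxi ha.symm
    have h2 : √2 = (b : ℝ) / a := by
      rw [eq_div_iff ha0]
      rw [← ha] at hb
      have : (2 * Real.pi) * (√2 * a - b) = 0 := by linarith
      rcases mul_eq_zero.1 this with h | h
      · linarith
      · linarith
    exact irrational_sqrt_two ⟨(b : ℚ) / a, by push_cast; exact h2.symm⟩
  have hae : ∀ φ : Measure (RVec m), φ {0} = 0 → (φ.withDensity f).withDensity f⁻¹ = φ := by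
    intro φ hφ
    refine withDensity_inv_same hf ?_ (ae_of_all _ fun x => ?_)
    · have : ∀ᵐ x ∂φ, x ≠ 0 := by
        rw [ae_iff]; simpa using hφ
      filter_upwards [this] with x hx using hpos x hx
    · exact ENNReal.sum_ne_top.2 fun _ _ => ENNReal.ofReal_ne_top
  rw [← hae φ₁ h₁, ← hae φ₂ h₂, hfeq]

/-- The characteristic function of `secondDifferenceMeasure` depends on the exponent alone, so the
exponent determines this measure. Its atom at `0` is `½⟨Q s, s⟩`, since `1 - cos` vanishes there;
the rest determines `φ`, and the remaining linear term of the exponent gives `γ`. -/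
theorem levyTriplet_unique {γ₁ γ₂ : RVec m} {Q₁ Q₂ : Matrix (Fin m) (Fin m) ℝ}
    {φ₁ φ₂ : Measure (RVec m)} (hQ₁ : Q₁.PosSemidef) (hQ₂ : Q₂.PosSemidef)
    (h₁ : IsLevyMeasure φ₁) (h₂ : IsLevyMeasure φ₂)
    (h : ∀ t, Complex.exp (levyExponent γ₁ Q₁ φ₁ t) = Complex.exp (levyExponent γ₂ Q₂ φ₂ t)) :
    γ₁ = γ₂ ∧ Q₁ = Q₂ ∧ φ₁ = φ₂ := by
  have hψ := levyExponent_eq_of_exp_eq h₁ h₂ h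
  have hmeas : ∀ s, secondDifferenceMeasure Q₁ φ₁ s = secondDifferenceMeasure Q₂ φ₂ s := by
    intro s
    have := h₁.isFiniteMeasure_secondDifferenceMeasure Q₁ s
    have := h₂.isFiniteMeasure_secondDifferenceMeasure Q₂ s
    apply Measure.ext_of_charFun
    ext t
    rw [charFun_secondDifferenceMeasure h₁ γ₁ hQ₁, charFun_secondDifferenceMeasure h₂ γ₂ hQ₂,
      hψ, hψ, hψ]
  have hzero : ∀ (φ : Measure (RVec m)) (s : RVec m), φ.withDensity
      (fun x => ENNReal.ofReal (1 - Real.cos (inner ℝ s x))) {0} = 0 := by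
    intro φ s
    rw [withDensity_apply _ (measurableSet_singleton 0), lintegral_singleton]
    simp
  have hq : ∀ s, ENNReal.ofReal (1 / 2 * quadForm Q₁ s) = ENNReal.ofReal (1 / 2 * quadForm Q₂ s) := by
    intro s
    have := congrArg (fun ν : Measure (RVec m) => ν {0}) (hmeas s)
    simpa [secondDifferenceMeasure, hzero] using this
  have hQ : Q₁ = Q₂ := by
    refine eq_of_quadForm_eq hQ₁.1 hQ₂.1 fun s => ?_
    have p1 := (posSemidef_iff_quadForm.1 hQ₁).2 s
    have p2 := (posSemidef_iff_quadForm.1 hQ₂).2 s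
    have := (ENNReal.ofReal_eq_ofReal_iff (by positivity) (by positivity)).1 (hq s)
    linarith
  have hφ : φ₁ = φ₂ := by
    refine eq_of_withDensity_one_sub_cos_eq h₁.measure_zero h₂.measure_zero fun s => ?_
    ext B hB
    have := congrArg (fun ν : Measure (RVec m) => ν B) (hmeas s)
    simp only [secondDifferenceMeasure, Measure.add_apply, hq] at this
    refine (ENNReal.add_left_inj (c := _) ?_).1 this
    rw [Measure.smul_apply]
    exact ENNReal.mul_ne_top ENNReal.ofReal_ne_top (measure_ne_top _ _)
  refine ⟨?_, hQ, hφ⟩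
  subst hQ hφ
  refine ext_inner_right ℝ fun t => ?_
  have := hψ t
  simp only [levyExponent_eq, add_left_inj, sub_left_inj] at this
  exact_mod_cast mul_left_cancel₀ Complex.I_ne_zero this

lemma HasLevyTriplet.unique {μ : Measure (RVec m)} {γ₁ γ₂ : RVec m}
    {Q₁ Q₂ : Matrix (Fin m) (Fin m) ℝ} {φ₁ φ₂ : Measure (RVec m)}
    (h₁ : HasLevyTriplet μ γ₁ Q₁ φ₁) (h₂ : HasLevyTriplet μ γ₂ Q₂ φ₂) :
    γ₁ = γ₂ ∧ Q₁ = Q₂ ∧ φ₁ = φ₂ :=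
  levyTriplet_unique h₁.posSemidef h₂.posSemidef h₁.isLevyMeasure h₂.isLevyMeasure
    fun t => by rw [← h₁.charFun_eq, h₂.charFun_eq]

lemma minSqIntegral_add (φ₁ φ₂ : Measure (RVec m)) :
    minSqIntegral (φ₁ + φ₂) = minSqIntegral φ₁ + minSqIntegral φ₂ := by
  simp [minSqIntegral, lintegral_add_measure]

lemma IsLevyMeasure.add {φ₁ φ₂ : Measure (RVec m)} (h₁ : IsLevyMeasure φ₁)
    (h₂ : IsLevyMeasure φ₂) : IsLevyMeasure (φ₁ + φ₂) where
  measure_zero := by simp [h₁.measure_zero, h₂.measure_zero]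
  minSqIntegral_lt_top := by
    rw [minSqIntegral_add]
    exact ENNReal.add_lt_top.2 ⟨h₁.minSqIntegral_lt_top, h₂.minSqIntegral_lt_top⟩

lemma HasLevyTriplet.add {μ₁ μ₂ μ : Measure (RVec m)} {γ₁ γ₂ : RVec m}
    {Q₁ Q₂ : Matrix (Fin m) (Fin m) ℝ} {φ₁ φ₂ : Measure (RVec m)}
    (h₁ : HasLevyTriplet μ₁ γ₁ Q₁ φ₁) (h₂ : HasLevyTriplet μ₂ γ₂ Q₂ φ₂)
    (hμ : ∀ t, charFun μ t = charFun μ₁ t * charFun μ₂ t) :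
    HasLevyTriplet μ (γ₁ + γ₂) (Q₁ + Q₂) (φ₁ + φ₂) where
  posSemidef := h₁.posSemidef.add h₂.posSemidef
  isLevyMeasure := h₁.isLevyMeasure.add h₂.isLevyMeasure
  charFun_eq t := by
    rw [hμ, h₁.charFun_eq, h₂.charFun_eq, ← Complex.exp_add]
    congr 1
    rw [levyExponent_eq, levyExponent_eq, levyExponent_eq,
      integral_add_measure (h₁.isLevyMeasure.integrable_levyKernel t)
        (h₂.isLevyMeasure.integrable_levyKernel t), map_add, LinearMap.add_apply, inner_add_left,
      inner_add_left]
    push_cast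
    ring

end Uniqueness

/-! ### Limits of compound Poisson exponents. -/

section Compactness

variable {m : ℕ}

lemma Ultrafilter.exists_tendsto_of_norm_le {ι E : Type*} [SeminormedAddCommGroup E] [ProperSpace E]
    (U : Ultrafilter ι) {f : ι → E} {C : ℝ} (h : ∀ i, ‖f i‖ ≤ C) : ∃ l, Tendsto f U (𝓝 l) := by
  obtain ⟨l, -, hl⟩ := (isCompact_closedBall (0 : E) C).ultrafilter_le_nhds' (U.map f)
    (Ultrafilter.mem_map.2 (Filter.univ_mem' fun i => by simpa using h i))
  exact ⟨l, hl⟩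

/-- The kernel `exp(i⟨t, x⟩) - 1 - i⟨t, x⟩/(1 + ‖x‖²) + ½⟨t, x⟩²/(1 + ‖x‖²)`, divided by
`‖x‖²/(1 + ‖x‖²)`: it is continuous and bounded, with value `0` at the origin. -/
def secondOrderKernel (t x : RVec m) : ℂ :=
  (levyKernel t x + (((inner ℝ t x : ℝ) ^ 2 / (2 * (1 + ‖x‖ ^ 2)) : ℝ) : ℂ))
    * (((1 + ‖x‖ ^ 2) / ‖x‖ ^ 2 : ℝ) : ℂ)

lemma secondOrderKernel_zero (t : RVec m) : secondOrderKernel t 0 = 0 := by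
  simp [secondOrderKernel]

/-- The constant in the bound of `secondOrderKernel t` for `‖t‖ ≤ R`. -/
def secondOrderBound (R : ℝ) : ℝ :=
  2 * (R ^ 3 * Real.exp R + R + R ^ 2) + 2 * (kernelBound R + R ^ 2)

lemma secondOrderBound_nonneg {R : ℝ} (hR : 0 ≤ R) : 0 ≤ secondOrderBound R := by
  unfold secondOrderBound kernelBound; positivity

lemma norm_exp_I_mul_sub_sub_le (u : ℝ) :
    ‖Complex.exp (Complex.I * (u : ℂ)) - 1 - Complex.I * (u : ℂ) + ((u ^ 2 / 2 : ℝ) : ℂ)‖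
      ≤ |u| ^ 3 * Real.exp |u| := by
  have h := Complex.norm_exp_sub_sum_le_norm_mul_exp (Complex.I * (u : ℂ)) 3
  simp only [Finset.sum_range_succ, Finset.range_zero, Finset.sum_empty, zero_add, pow_zero,
    Nat.factorial, Nat.cast_one, div_one, pow_one, mul_pow, Complex.I_sq, norm_mul,
    Complex.norm_I, one_mul, Complex.norm_real, Real.norm_eq_abs] at h
  refine le_trans (le_of_eq ?_) h
  congr 1
  push_cast
  ring

/-- Adding the quadratic term makes the Taylor remainder cubic, so after division by `‖x‖²` it is
still `O(‖x‖)`. This gives continuity at the origin, without which weak convergence could not be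
applied to `secondOrderKernel`. -/
lemma norm_secondOrderKernel_le_mul_norm {R : ℝ} {t : RVec m} (ht : ‖t‖ ≤ R) {x : RVec m}
    (hx : ‖x‖ ≤ 1) : ‖secondOrderKernel t x‖ ≤ secondOrderBound R * ‖x‖ := by
  rcases eq_or_ne x 0 with rfl | hx0
  · simp [secondOrderKernel_zero]
  have hR : 0 ≤ R := (norm_nonneg t).trans ht
  have hu := abs_inner_le_mul_norm ht x
  have hxp : 0 < ‖x‖ := norm_pos_iff.2 hx0
  set u : ℝ := inner ℝ t x with hu_def
  have hpos : 0 < 1 + ‖x‖ ^ 2 := by positivity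
  have h1 : secondOrderKernel t x = (Complex.exp (Complex.I * (u : ℂ)) - 1 - Complex.I * (u : ℂ)
      + ((u ^ 2 / 2 : ℝ) : ℂ)) * (((1 + ‖x‖ ^ 2) / ‖x‖ ^ 2 : ℝ) : ℂ)
      + (Complex.I * (u : ℂ) - ((u ^ 2 / 2 : ℝ) : ℂ)) := by
    have h2 : ((1 : ℂ) + (‖x‖ : ℂ) ^ 2) ≠ 0 := one_add_norm_sq_ne_zero x
    have h3 : (‖x‖ : ℂ) ≠ 0 := by exact_mod_cast hxp.ne'
    unfold secondOrderKernel levyKernel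
    rw [← hu_def]
    push_cast
    field_simp
    ring
  have huR : |u| ≤ R := hu.trans (by nlinarith)
  have h2 : |u| ^ 3 * Real.exp |u| ≤ (R * ‖x‖) ^ 3 * Real.exp R := by gcongr
  have h3 : ‖(((1 + ‖x‖ ^ 2) / ‖x‖ ^ 2 : ℝ) : ℂ)‖ ≤ 2 / ‖x‖ ^ 2 := by
    rw [Complex.norm_real, Real.norm_eq_abs, abs_of_nonneg (by positivity)]
    gcongr
    nlinarith
  have h4 : ‖Complex.I * (u : ℂ) - ((u ^ 2 / 2 : ℝ) : ℂ)‖ ≤ (R + R ^ 2) * ‖x‖ := by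
    refine (norm_sub_le _ _).trans ?_
    rw [norm_mul, Complex.norm_I, one_mul, Complex.norm_real, Complex.norm_real, Real.norm_eq_abs,
      Real.norm_eq_abs, abs_of_nonneg (by positivity : 0 ≤ u ^ 2 / 2), ← sq_abs u]
    nlinarith [abs_nonneg u, mul_le_mul hu huR (abs_nonneg u) (by positivity)]
  rw [h1]
  refine (norm_add_le _ _).trans ?_
  rw [norm_mul]
  have h5 : ‖Complex.exp (Complex.I * (u : ℂ)) - 1 - Complex.I * (u : ℂ)
      + ((u ^ 2 / 2 : ℝ) : ℂ)‖ * ‖(((1 + ‖x‖ ^ 2) / ‖x‖ ^ 2 : ℝ) : ℂ)‖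
      ≤ 2 * (R ^ 3 * Real.exp R) * ‖x‖ := by
    refine (mul_le_mul ((norm_exp_I_mul_sub_sub_le u).trans h2) h3 (norm_nonneg _)
      (by positivity)).trans (le_of_eq ?_)
    field_simp
  have h6 : 0 ≤ kernelBound R := by unfold kernelBound; positivity
  have h7 : 0 ≤ (R + R ^ 2) * ‖x‖ := by positivity
  have h8 : 0 ≤ (kernelBound R + R ^ 2) * ‖x‖ := by positivity
  unfold secondOrderBound
  nlinarith

lemma norm_secondOrderKernel_le {R : ℝ} {t : RVec m} (ht : ‖t‖ ≤ R) (x : RVec m) :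
    ‖secondOrderKernel t x‖ ≤ secondOrderBound R := by
  have hR : 0 ≤ R := (norm_nonneg t).trans ht
  rcases le_total ‖x‖ 1 with hx | hx
  · exact (norm_secondOrderKernel_le_mul_norm ht hx).trans
      (mul_le_of_le_one_right (secondOrderBound_nonneg hR) hx)
  · have hk := norm_levyKernel_le ht x
    rw [minSq_of_one_le_norm hx, mul_one] at hk
    have hu := abs_inner_le_mul_norm ht x
    have hpos : 0 < 1 + ‖x‖ ^ 2 := by positivity
    have h1 : ‖(((inner ℝ t x : ℝ) ^ 2 / (2 * (1 + ‖x‖ ^ 2)) : ℝ) : ℂ)‖ ≤ R ^ 2 := by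
      rw [Complex.norm_real, Real.norm_eq_abs, abs_of_nonneg (by positivity),
        div_le_iff₀ (by positivity), ← sq_abs]
      have h2 := pow_le_pow_left₀ (abs_nonneg _) hu 2
      nlinarith [mul_nonneg (sq_nonneg R) (sq_nonneg ‖x‖), sq_nonneg R]
    have h3 : ‖(((1 + ‖x‖ ^ 2) / ‖x‖ ^ 2 : ℝ) : ℂ)‖ ≤ 2 := by
      rw [Complex.norm_real, Real.norm_eq_abs, abs_of_nonneg (by positivity),
        div_le_iff₀ (by positivity)]
      nlinarith
    have h6 : 0 ≤ kernelBound R := by unfold kernelBound; positivity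
    unfold secondOrderKernel
    rw [norm_mul]
    refine (mul_le_mul ((norm_add_le _ _).trans (add_le_add hk h1)) h3 (norm_nonneg _)
      (by positivity)).trans ?_
    have : 0 ≤ R ^ 3 * Real.exp R + R + R ^ 2 := by positivity
    unfold secondOrderBound
    linarith

lemma continuous_secondOrderKernel (t : RVec m) : Continuous (secondOrderKernel t) := by
  rw [continuous_iff_continuousAt]
  intro x
  rcases eq_or_ne x 0 with rfl | hx
  · rw [ContinuousAt, secondOrderKernel_zero]
    refine squeeze_zero_norm' (a := fun x : RVec m => secondOrderBound ‖t‖ * ‖x‖) ?_ ?_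
    · filter_upwards [Metric.closedBall_mem_nhds (0 : RVec m) one_pos] with x hx
      exact norm_secondOrderKernel_le_mul_norm le_rfl (by simpa using hx)
    · have : Continuous fun x : RVec m => secondOrderBound ‖t‖ * ‖x‖ := by fun_prop
      simpa using this.tendsto 0
  · unfold secondOrderKernel
    refine ContinuousAt.mul (ContinuousAt.add (continuous_levyKernel_right t).continuousAt ?_) ?_
    · refine Complex.continuous_ofReal.continuousAt.comp (ContinuousAt.div (by fun_prop)
        (by fun_prop) ?_)
      positivity
    · refine Complex.continuous_ofReal.continuousAt.comp (ContinuousAt.div (by fun_prop)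
        (by fun_prop) ?_)
      have := norm_pos_iff.2 hx
      positivity

/-- `secondOrderKernel t` as a bounded continuous function. -/
def secondOrderKernelBCF (t : RVec m) : BoundedContinuousFunction (RVec m) ℂ :=
  BoundedContinuousFunction.ofNormedAddCommGroup (secondOrderKernel t)
    (continuous_secondOrderKernel t) (secondOrderBound ‖t‖) (norm_secondOrderKernel_le le_rfl)

/-- The weight `‖x‖²/(1 + ‖x‖²)`. -/
def ratioWeight (x : RVec m) : ℝ := ‖x‖ ^ 2 / (1 + ‖x‖ ^ 2)

lemma continuous_ratioWeight : Continuous (ratioWeight : RVec m → ℝ) := by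
  unfold ratioWeight
  refine Continuous.div (by fun_prop) (by fun_prop) fun x => ?_
  positivity

lemma ratioWeight_nonneg (x : RVec m) : 0 ≤ ratioWeight x := by unfold ratioWeight; positivity

lemma ratioWeight_le_minSq (x : RVec m) : ratioWeight x ≤ minSq x := by
  have hpos : 0 < 1 + ‖x‖ ^ 2 := by positivity
  refine le_min ?_ ?_
  · unfold ratioWeight; rw [div_le_one hpos]; linarith
  · exact div_le_self (by positivity) (by nlinarith [sq_nonneg ‖x‖])

lemma ratioWeight_le_one (x : RVec m) : ratioWeight x ≤ 1 :=
  (ratioWeight_le_minSq x).trans (minSq_le_one x)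

lemma ratioWeight_inv (x : RVec m) : (1 + ‖x‖ ^ 2) / ‖x‖ ^ 2 = (ratioWeight x)⁻¹ := by
  rw [ratioWeight, inv_div]

lemma ratioWeight_mul_secondOrderKernel (t x : RVec m) :
    (ratioWeight x : ℂ) * secondOrderKernel t x
      = levyKernel t x + (((inner ℝ t x : ℝ) ^ 2 / (2 * (1 + ‖x‖ ^ 2)) : ℝ) : ℂ) := by
  rcases eq_or_ne x 0 with rfl | hx
  · simp [secondOrderKernel_zero, levyKernel]
  · have hx' : ratioWeight x ≠ 0 := by
      have := norm_pos_iff.2 hx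
      unfold ratioWeight; positivity
    have hx'' : (ratioWeight x : ℂ) ≠ 0 := by exact_mod_cast hx'
    rw [secondOrderKernel, ratioWeight_inv, Complex.ofReal_inv]
    field_simp

lemma minSq_mul_ratioWeight_inv_le (x : RVec m) : minSq x * (ratioWeight x)⁻¹ ≤ 2 := by
  rcases eq_or_ne x 0 with rfl | hx
  · simp [ratioWeight]
  have hxp := norm_pos_iff.2 hx
  rw [← ratioWeight_inv, mul_div_assoc', div_le_iff₀ (by positivity)]
  have h1 := minSq_le_one x
  have h2 := minSq_le_sq x
  nlinarith [sq_nonneg ‖x‖]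

lemma abs_coord_mul_coord_le (x : RVec m) (i j : Fin m) : |x i * x j| ≤ ‖x‖ ^ 2 := by
  have hi : |x i| ≤ ‖x‖ := by simpa using PiLp.norm_apply_le x i
  have hj : |x j| ≤ ‖x‖ := by simpa using PiLp.norm_apply_le x j
  rw [abs_mul, sq]
  exact mul_le_mul hi hj (abs_nonneg _) (norm_nonneg _)

lemma abs_coord_mul_div_le (x : RVec m) (i j : Fin m) :
    |x i * x j / (1 + ‖x‖ ^ 2)| ≤ ratioWeight x := by
  have hpos : 0 < 1 + ‖x‖ ^ 2 := by positivity
  rw [abs_div, abs_of_pos hpos, ratioWeight]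
  gcongr
  exact abs_coord_mul_coord_le x i j

lemma abs_coord_mul_div_norm_sq_le (x : RVec m) (i j : Fin m) :
    |x i * x j / ‖x‖ ^ 2| ≤ 1 := by
  rw [abs_div, abs_of_nonneg (sq_nonneg ‖x‖)]
  exact div_le_one_of_le₀ (abs_coord_mul_coord_le x i j) (sq_nonneg _)

lemma inner_sq_eq_sum (t x : RVec m) :
    (inner ℝ t x : ℝ) ^ 2 = ∑ i, ∑ j, (t i * t j) * (x i * x j) := by
  simp only [PiLp.inner_apply, RCLike.inner_apply, conj_trivial]
  rw [sq, Finset.sum_mul_sum]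
  exact Finset.sum_congr rfl fun i _ => Finset.sum_congr rfl fun j _ => by ring

lemma continuous_coord_mul_div (i j : Fin m) :
    Continuous fun x : RVec m => x i * x j / (1 + ‖x‖ ^ 2) :=
  Continuous.div (by fun_prop) (by fun_prop) fun x => by positivity

lemma integrable_coord_mul_div (φ : Measure (RVec m)) [IsFiniteMeasure φ] (i j : Fin m) :
    Integrable (fun x : RVec m => x i * x j / (1 + ‖x‖ ^ 2)) φ :=
  Integrable.of_bound (continuous_coord_mul_div i j).aestronglyMeasurable 1
    (ae_of_all _ fun x => (abs_coord_mul_div_le x i j).trans (ratioWeight_le_one x))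

lemma integrable_coord_mul_div_norm_sq (φ : Measure (RVec m)) [IsFiniteMeasure φ] (i j : Fin m) :
    Integrable (fun x : RVec m => x i * x j / ‖x‖ ^ 2) φ := by
  refine Integrable.of_bound (Measurable.aestronglyMeasurable ?_) 1
    (ae_of_all _ fun x => abs_coord_mul_div_norm_sq_le x i j)
  have h1 : Measurable fun x : RVec m => x i * x j := (by fun_prop : Continuous _).measurable
  have h2 : Measurable fun x : RVec m => ‖x‖ ^ 2 := (by fun_prop : Continuous _).measurable
  exact h1.div h2

lemma integral_inner_sq_div_one_add (φ : Measure (RVec m)) [IsFiniteMeasure φ] (t : RVec m) :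
    ∫ x, (inner ℝ t x : ℝ) ^ 2 / (1 + ‖x‖ ^ 2) ∂φ
      = ∑ i, ∑ j, (t i * t j) * ∫ x : RVec m, x i * x j / (1 + ‖x‖ ^ 2) ∂φ := by
  simp only [inner_sq_eq_sum, Finset.sum_div, mul_div_assoc]
  rw [integral_finsetSum _ fun i _ => integrable_finsetSum _ fun j _ => by
    simpa only [mul_div_assoc] using (integrable_coord_mul_div φ i j).const_mul (t i * t j)]
  refine Finset.sum_congr rfl fun i _ => ?_
  rw [integral_finsetSum _ fun j _ => by
    simpa only [mul_div_assoc] using (integrable_coord_mul_div φ i j).const_mul (t i * t j)]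
  exact Finset.sum_congr rfl fun j _ => integral_const_mul _ _

lemma integral_inner_sq_div (φ : Measure (RVec m)) [IsFiniteMeasure φ] (t : RVec m) :
    ∫ x, (inner ℝ t x : ℝ) ^ 2 / ‖x‖ ^ 2 ∂φ
      = ∑ i, ∑ j, (t i * t j) * ∫ x : RVec m, x i * x j / ‖x‖ ^ 2 ∂φ := by
  simp only [inner_sq_eq_sum, Finset.sum_div, mul_div_assoc]
  rw [integral_finsetSum _ fun i _ => integrable_finsetSum _ fun j _ => by
    simpa only [mul_div_assoc] using (integrable_coord_mul_div_norm_sq φ i j).const_mul (t i * t j)]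
  refine Finset.sum_congr rfl fun i _ => ?_
  rw [integral_finsetSum _ fun j _ => by
    simpa only [mul_div_assoc] using (integrable_coord_mul_div_norm_sq φ i j).const_mul (t i * t j)]
  exact Finset.sum_congr rfl fun j _ => integral_const_mul _ _

lemma integrable_inner_sq_div (φ : Measure (RVec m)) [IsFiniteMeasure φ] (t : RVec m) :
    Integrable (fun x => (inner ℝ t x : ℝ) ^ 2 / ‖x‖ ^ 2) φ := by
  simp only [inner_sq_eq_sum, Finset.sum_div, mul_div_assoc]
  exact integrable_finsetSum _ fun i _ => integrable_finsetSum _ fun j _ => by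
    simpa only [mul_div_assoc] using (integrable_coord_mul_div_norm_sq φ i j).const_mul (t i * t j)

lemma integrable_inner_sq_div_one_add (φ : Measure (RVec m)) [IsFiniteMeasure φ] (t : RVec m) :
    Integrable (fun x => (inner ℝ t x : ℝ) ^ 2 / (1 + ‖x‖ ^ 2)) φ := by
  simp only [inner_sq_eq_sum, Finset.sum_div, mul_div_assoc]
  exact integrable_finsetSum _ fun i _ => integrable_finsetSum _ fun j _ => by
    simpa only [mul_div_assoc] using (integrable_coord_mul_div φ i j).const_mul (t i * t j)

/-- The drift `∫ x/(1 + ‖x‖²) φ(dx)` of a finite measure. -/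
def drift (φ : Measure (RVec m)) : RVec m := ∫ x, (1 + ‖x‖ ^ 2)⁻¹ • x ∂φ

lemma integrable_drift (φ : Measure (RVec m)) [IsFiniteMeasure φ] :
    Integrable (fun x : RVec m => (1 + ‖x‖ ^ 2)⁻¹ • x) φ := by
  refine Integrable.of_bound (Continuous.aestronglyMeasurable ?_) 1 (ae_of_all _ fun x => ?_)
  · have h : Continuous fun x : RVec m => (1 + ‖x‖ ^ 2) := by fun_prop
    refine (h.inv₀ fun x => ?_).smul continuous_id
    positivity
  · have hpos : 0 < 1 + ‖x‖ ^ 2 := by positivity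
    rw [norm_smul, norm_inv, Real.norm_of_nonneg hpos.le, inv_mul_le_iff₀ hpos]
    nlinarith [sq_nonneg (‖x‖ - 1), norm_nonneg x]

lemma integrable_levyKernel_of_isFiniteMeasure (φ : Measure (RVec m)) [IsFiniteMeasure φ]
    (t : RVec m) : Integrable (levyKernel t) φ := by
  refine Integrable.of_bound (continuous_levyKernel_right t).aestronglyMeasurable (kernelBound ‖t‖)
    (ae_of_all _ fun x => (norm_levyKernel_le le_rfl x).trans ?_)
  exact mul_le_of_le_one_right (by unfold kernelBound; positivity) (minSq_le_one x)

/-- The compound Poisson exponent with jump measure `φ` in Lévy–Khintchine form: a drift and a jump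
part, no Gaussian part. -/
lemma integral_exp_sub_one_eq (φ : Measure (RVec m)) [IsFiniteMeasure φ] (t : RVec m) :
    ∫ x, (Complex.exp (Complex.I * ((inner ℝ t x : ℝ) : ℂ)) - 1) ∂φ
      = Complex.I * ((inner ℝ (drift φ) t : ℝ) : ℂ) + ∫ x, levyKernel t x ∂φ := by
  have h1 : (inner ℝ (drift φ) t : ℝ) = ∫ x : RVec m, inner ℝ t ((1 + ‖x‖ ^ 2)⁻¹ • x) ∂φ := by
    rw [real_inner_comm, drift]
    exact (integral_inner (integrable_drift φ) t).symm
  have h2 : Integrable (fun x : RVec m => (inner ℝ t ((1 + ‖x‖ ^ 2)⁻¹ • x) : ℝ)) φ :=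
    (integrable_drift φ).const_inner t
  have h3 : Integrable (fun x : RVec m =>
      Complex.I * ((inner ℝ t ((1 + ‖x‖ ^ 2)⁻¹ • x) : ℝ) : ℂ)) φ := h2.ofReal.const_mul _
  rw [h1, ← integral_complex_ofReal, ← integral_const_mul,
    ← integral_add h3 (integrable_levyKernel_of_isFiniteMeasure φ t)]
  refine integral_congr_ae (ae_of_all _ fun x => ?_)
  simp only [levyKernel, real_inner_smul_right]
  push_cast
  ring

/-- The finite measure `‖x‖²/(1 + ‖x‖²) φ(dx)`. -/
def weighted (φ : Measure (RVec m)) : Measure (RVec m) :=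
  φ.withDensity fun x => ENNReal.ofReal (ratioWeight x)

lemma weighted_le (φ : Measure (RVec m)) : weighted φ ≤ φ := by
  calc weighted φ ≤ φ.withDensity 1 := withDensity_mono (ae_of_all _ fun x => by
        simpa using ENNReal.ofReal_le_ofReal (ratioWeight_le_one x))
    _ = φ := withDensity_one

instance isFiniteMeasure_weighted (φ : Measure (RVec m)) [IsFiniteMeasure φ] :
    IsFiniteMeasure (weighted φ) := isFiniteMeasure_of_le φ (weighted_le φ)

lemma weighted_univ_le (φ : Measure (RVec m)) : weighted φ Set.univ ≤ minSqIntegral φ := by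
  rw [weighted, withDensity_apply _ MeasurableSet.univ, setLIntegral_univ]
  exact lintegral_mono fun x => ENNReal.ofReal_le_ofReal (ratioWeight_le_minSq x)

/-- Splits the jump part into finitely many scalars, the truncated second moments, and the integral
of a bounded continuous function against a finite measure. Each piece passes to a limit even when
jumps accumulate at the origin. -/
lemma integral_levyKernel_eq_weighted (φ : Measure (RVec m)) [IsFiniteMeasure φ] (t : RVec m) :
    ∫ x, levyKernel t x ∂φ = -(1 / 2 : ℂ) * ((∑ i, ∑ j, (t i * t j) *
        ∫ x : RVec m, x i * x j / (1 + ‖x‖ ^ 2) ∂φ : ℝ) : ℂ)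
      + ∫ x, secondOrderKernel t x ∂(weighted φ) := by
  have h1 : ∫ x, secondOrderKernel t x ∂(weighted φ)
      = ∫ x, levyKernel t x ∂φ
        + (1 / 2 : ℂ) * ((∫ x, (inner ℝ t x : ℝ) ^ 2 / (1 + ‖x‖ ^ 2) ∂φ : ℝ) : ℂ) := by
    have h3 : Integrable (fun x : RVec m => (1 / 2 : ℂ) *
      (((inner ℝ t x : ℝ) ^ 2 / (1 + ‖x‖ ^ 2) : ℝ) : ℂ)) φ :=
      (integrable_inner_sq_div_one_add φ t).ofReal.const_mul _
    rw [← integral_complex_ofReal, ← integral_const_mul,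
      ← integral_add (integrable_levyKernel_of_isFiniteMeasure φ t) h3, weighted,
      integral_withDensity_eq_integral_toReal_smul
        continuous_ratioWeight.measurable.ennreal_ofReal (ae_of_all _ fun _ => ENNReal.ofReal_lt_top)]
    refine integral_congr_ae (ae_of_all _ fun x => ?_)
    simp only
    rw [ENNReal.toReal_ofReal (ratioWeight_nonneg x), Complex.real_smul,
      ratioWeight_mul_secondOrderKernel]
    push_cast
    field_simp
  rw [h1, integral_inner_sq_div_one_add]
  ring

/-- The Lévy measure `(1 + ‖x‖²)/‖x‖² κ(dx)` off the origin. -/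
def unweighted (κ : Measure (RVec m)) : Measure (RVec m) :=
  κ.withDensity fun x => ENNReal.ofReal (ratioWeight x)⁻¹

lemma measurable_ratioWeight_inv :
    Measurable fun x : RVec m => ENNReal.ofReal (ratioWeight x)⁻¹ :=
  continuous_ratioWeight.measurable.inv.ennreal_ofReal

lemma isLevyMeasure_unweighted (κ : Measure (RVec m)) [IsFiniteMeasure κ] :
    IsLevyMeasure (unweighted κ) where
  measure_zero := by
    rw [unweighted, withDensity_apply _ (measurableSet_singleton 0), lintegral_singleton]
    -- The density at `0` is `0⁻¹ = 0`, so an atom of `κ` at the origin is discarded.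
    simp [ratioWeight]
  minSqIntegral_lt_top := by
    rw [minSqIntegral_eq, unweighted, lintegral_withDensity_eq_lintegral_mul _
      measurable_ratioWeight_inv continuous_minSq.measurable.ennreal_ofReal]
    calc _ ≤ ∫⁻ _x : RVec m, 2 ∂κ := lintegral_mono fun x => by
            rw [Pi.mul_apply, mul_comm, ← ENNReal.ofReal_mul (minSq_nonneg x)]
            exact (ENNReal.ofReal_le_ofReal (minSq_mul_ratioWeight_inv_le x)).trans_eq (by simp)
      _ < ∞ := by
            rw [lintegral_const]
            exact ENNReal.mul_lt_top (by simp) (measure_lt_top _ _)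

/-- The splitting of `integral_levyKernel_eq_weighted` for the limit measure. An atom of `κ` at `0`
contributes nothing on either side, since `secondOrderKernel t 0 = 0` and `0 / 0 = 0`. -/
lemma integral_levyKernel_unweighted (κ : Measure (RVec m)) [IsFiniteMeasure κ] (t : RVec m) :
    ∫ x, levyKernel t x ∂(unweighted κ) = ∫ x, secondOrderKernel t x ∂κ
      - (1 / 2 : ℂ) * ((∑ i, ∑ j, (t i * t j) * ∫ x : RVec m, x i * x j / ‖x‖ ^ 2 ∂κ : ℝ) : ℂ) := by
  have h3 : Integrable (fun x : RVec m => (1 / 2 : ℂ) *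
      (((inner ℝ t x : ℝ) ^ 2 / ‖x‖ ^ 2 : ℝ) : ℂ)) κ :=
    (integrable_inner_sq_div κ t).ofReal.const_mul _
  have h4 : Integrable (secondOrderKernel t) κ :=
    (secondOrderKernelBCF t).integrable κ
  rw [← integral_inner_sq_div, ← integral_complex_ofReal, ← integral_const_mul,
    ← integral_sub h4 h3, unweighted,
    integral_withDensity_eq_integral_toReal_smul measurable_ratioWeight_inv
      (ae_of_all _ fun _ => ENNReal.ofReal_lt_top)]
  refine integral_congr_ae (ae_of_all _ fun x => ?_)
  simp only
  rw [ENNReal.toReal_ofReal (inv_nonneg.2 (ratioWeight_nonneg x)), Complex.real_smul]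
  rcases eq_or_ne x 0 with rfl | hx
  · simp [secondOrderKernel_zero, levyKernel]
  · have h2 : ((1 : ℂ) + (‖x‖ : ℂ) ^ 2) ≠ 0 := one_add_norm_sq_ne_zero x
    have h3 : (‖x‖ : ℂ) ≠ 0 := by exact_mod_cast (norm_pos_iff.2 hx).ne'
    rw [secondOrderKernel, ← ratioWeight_inv]
    push_cast
    field_simp
    ring

/-- Compactness of families of Lévy measures: along an ultrafilter, the exponents of compound
Poisson laws whose jump measures are tight converge to a Lévy–Khintchine exponent. -/
theorem exists_tendsto_levyExponent (U : Ultrafilter ℕ) (φ : ℕ → Measure (RVec m))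
    [∀ n, IsFiniteMeasure (φ n)] {C : ℝ} (hmass : ∀ n, minSqIntegral (φ n) ≤ ENNReal.ofReal C)
    (htight : ∀ ε : ℝ, 0 < ε → ∃ R : ℝ, ∀ n, φ n (Metric.closedBall 0 R)ᶜ ≤ ENNReal.ofReal ε)
    (hdrift : ∀ n, ‖drift (φ n)‖ ≤ C) :
    ∃ (γ : RVec m) (Q : Matrix (Fin m) (Fin m) ℝ) (ψ : Measure (RVec m)), Q.IsHermitian ∧
      IsLevyMeasure ψ ∧ ∀ t, Tendsto (fun n => ∫ x,
        (Complex.exp (Complex.I * ((inner ℝ t x : ℝ) : ℂ)) - 1) ∂(φ n)) U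
        (𝓝 (levyExponent γ Q ψ t)) := by
  obtain ⟨γ, hγ⟩ := U.exists_tendsto_of_norm_le hdrift
  have hq : ∀ i j, ∃ q : ℝ, Tendsto (fun n => ∫ x : RVec m, x i * x j / (1 + ‖x‖ ^ 2) ∂(φ n))
      U (𝓝 q) := by
    intro i j
    refine U.exists_tendsto_of_norm_le (C := max C 0) fun n => ?_
    have hint : Integrable (minSq (m := m)) (φ n) :=
      Integrable.of_bound continuous_minSq.aestronglyMeasurable 1 (ae_of_all _ fun x => by
        rw [Real.norm_of_nonneg (minSq_nonneg x)]; exact minSq_le_one x)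
    have h1 : ∫ x, minSq x ∂(φ n) ≤ max C 0 := by
      rw [integral_eq_lintegral_of_nonneg_ae (ae_of_all _ minSq_nonneg) hint.1]
      refine (ENNReal.toReal_mono ENNReal.ofReal_ne_top (hmass n)).trans ?_
      rw [ENNReal.toReal_ofReal']
    refine (norm_integral_le_of_norm_le hint (ae_of_all _ fun x => ?_)).trans h1
    exact (abs_coord_mul_div_le x i j).trans (ratioWeight_le_minSq x)
  choose q hq using hq
  have hqsymm : ∀ i j, q i j = q j i := fun i j =>
    tendsto_nhds_unique (hq i j) ((hq j i).congr fun n => by simp only [mul_comm])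
  choose! R hR using htight
  -- Prokhorov: the weighted measures have bounded mass and are uniformly small off the balls of
  -- radius `R (1 / (k + 1))`, so they converge weakly along the ultrafilter.
  have hK := isCompact_setOfPred_finiteMeasure_mass_le_compl_isCompact_le (E := RVec m)
    (u := fun k => Real.toNNReal (1 / ((k : ℝ) + 1)))
    (K := fun k => Metric.closedBall 0 (R (1 / ((k : ℝ) + 1)))) (Real.toNNReal C)
    (by
      have := (continuous_real_toNNReal.tendsto 0).comp
        (tendsto_one_div_add_atTop_nhds_zero_nat (𝕜 := ℝ))
      simpa [Function.comp_def] using this)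
    (fun k => isCompact_closedBall _ _) (Or.inl inferInstance)
  let κ : ℕ → FiniteMeasure (RVec m) := fun n => ⟨weighted (φ n), inferInstance⟩
  obtain ⟨κ₀, -, hκ⟩ := hK.ultrafilter_le_nhds' (U.map κ) (Ultrafilter.mem_map.2
    (Filter.univ_mem' fun n => by
      refine ⟨?_, fun k => ?_⟩
      · rw [← ENNReal.coe_le_coe, FiniteMeasure.ennreal_mass]
        exact (weighted_univ_le _).trans (hmass n)
      · rw [← ENNReal.coe_le_coe, FiniteMeasure.ennreal_coeFn_eq_coeFn_toMeasure]
        exact (weighted_le _ _).trans (hR _ (by positivity) n)))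
  have hκ' : Tendsto κ U (𝓝 κ₀) := hκ
  rw [FiniteMeasure.tendsto_iff_forall_integral_rclike_tendsto ℂ] at hκ'
  -- The Gaussian covariance is the limit of the truncated second moments minus the part that the
  -- limit measure accounts for off the origin: jumps that shrink to `0` become Gaussian.
  refine ⟨γ, Matrix.of fun i j =>
      q i j - ∫ x : RVec m, x i * x j / ‖x‖ ^ 2 ∂(κ₀ : Measure (RVec m)), unweighted κ₀, ?_, isLevyMeasure_unweighted _, fun t => ?_⟩
  · ext i j
    simp only [Matrix.conjTranspose_apply, star_trivial, Matrix.of_apply]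
    rw [hqsymm j i]
    simp only [mul_comm]
  · have hlim : levyExponent γ (Matrix.of fun i j => q i j - ∫ x : RVec m, x i * x j / ‖x‖ ^ 2
          ∂(κ₀ : Measure (RVec m))) (unweighted κ₀) t
        = Complex.I * ((inner ℝ γ t : ℝ) : ℂ)
          + (-(1 / 2 : ℂ) * ((∑ i, ∑ j, (t i * t j) * q i j : ℝ) : ℂ)
            + ∫ x, secondOrderKernel t x ∂(κ₀ : Measure (RVec m))) := by
      rw [levyExponent_eq, ← quadForm, quadForm_eq_sum, integral_levyKernel_unweighted]
      simp only [Matrix.of_apply, sub_mul, Finset.sum_sub_distrib, mul_comm (q _ _),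
        mul_comm (∫ x : RVec m, _ ∂(κ₀ : Measure (RVec m)))]
      push_cast
      ring
    rw [hlim]
    simp only [integral_exp_sub_one_eq, integral_levyKernel_eq_weighted]
    refine Tendsto.add (Tendsto.const_mul _ ?_) (Tendsto.add (Tendsto.const_mul _ ?_) ?_)
    · exact (Complex.continuous_ofReal.tendsto _).comp (hγ.inner tendsto_const_nhds)
    · refine (Complex.continuous_ofReal.tendsto _).comp ?_
      exact tendsto_finsetSum _ fun i _ => tendsto_finsetSum _ fun j _ => (hq i j).const_mul _
    · exact hκ' (secondOrderKernelBCF t)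

end Compactness

/-! ### Existence of the triplet of an infinitely divisible law. -/

section Existence

variable {m : ℕ}

lemma quadForm_smul (Q : Matrix (Fin m) (Fin m) ℝ) (c : ℝ) (t : RVec m) :
    quadForm Q (c • t) = c ^ 2 * quadForm Q t := by
  simp only [quadForm, map_smul, real_inner_smul_left, real_inner_smul_right]
  ring

/-- An integrable majorant uniform in `c`: `1 - cos y ≤ y²/2` serves for `‖x‖ ≤ 1`, and `1 - cos y ≤
2` with `c ≥ 1` serves otherwise. -/
lemma one_sub_cos_mul_div_sq_le (t x : RVec m) {c : ℝ} (hc : 1 ≤ c) :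
    (1 - Real.cos (c * inner ℝ t x)) / c ^ 2 ≤ (2 + ‖t‖ ^ 2) * minSq x := by
  have hc2 : 0 < c ^ 2 := by positivity
  rw [div_le_iff₀ hc2]
  rcases le_total ‖x‖ 1 with hx | hx
  · rw [minSq_of_norm_le_one hx]
    have h1 := Real.one_sub_sq_div_two_le_cos (x := c * inner ℝ t x)
    have h2 := pow_le_pow_left₀ (abs_nonneg _) (abs_inner_le_mul_norm le_rfl x (t := t)) 2
    rw [sq_abs] at h2
    have h3 : 0 ≤ ‖x‖ ^ 2 * c ^ 2 := by positivity
    have h4 : (c * inner ℝ t x) ^ 2 ≤ (‖t‖ * ‖x‖) ^ 2 * c ^ 2 := by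
      rw [mul_pow, mul_comm]; gcongr
    have h5 : 0 ≤ (‖t‖ * ‖x‖) ^ 2 * c ^ 2 := by positivity
    nlinarith
  · rw [minSq_of_one_le_norm hx, mul_one]
    have := Real.neg_one_le_cos (c * inner ℝ t x)
    have h3 : 1 ≤ c ^ 2 := by nlinarith
    nlinarith [sq_nonneg ‖t‖]

/-- The real part of the exponent at `c t` is non-positive. Divided by `c²` as `c → ∞`, its jump
part vanishes by dominated convergence and `-½⟨Q t, t⟩` remains. -/
lemma posSemidef_of_norm_exp_levyExponent_le_one {φ : Measure (RVec m)} (hφ : IsLevyMeasure φ)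
    (γ : RVec m) {Q : Matrix (Fin m) (Fin m) ℝ} (hQ : Q.IsHermitian)
    (h : ∀ t, ‖Complex.exp (levyExponent γ Q φ t)‖ ≤ 1) : Q.PosSemidef := by
  refine posSemidef_iff_quadForm.2 ⟨hQ, fun t => ?_⟩
  have hlim : Tendsto (fun k : ℕ => ∫ x, (1 - Real.cos (((k : ℝ) + 1) * inner ℝ t x))
      / ((k : ℝ) + 1) ^ 2 ∂φ) atTop (𝓝 (∫ _x : RVec m, (0 : ℝ) ∂φ)) := by
    refine tendsto_integral_of_dominated_convergence (fun x => (2 + ‖t‖ ^ 2) * minSq x)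
      (fun k => Continuous.aestronglyMeasurable (by fun_prop)) (hφ.integrable_minSq.const_mul _)
      (fun k => ae_of_all _ fun x => ?_) (ae_of_all _ fun x => ?_)
    · rw [Real.norm_of_nonneg (div_nonneg (sub_nonneg.2 (Real.cos_le_one _)) (sq_nonneg _))]
      exact one_sub_cos_mul_div_sq_le t x (by simp)
    · refine squeeze_zero (g := fun k : ℕ => 2 * (1 / ((k : ℝ) + 1)))
        (fun k => div_nonneg (sub_nonneg.2 (Real.cos_le_one _)) (sq_nonneg _)) (fun k => ?_) ?_
      · have h1 : (0 : ℝ) < (k : ℝ) + 1 := by positivity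
        have h2 := Real.neg_one_le_cos (((k : ℝ) + 1) * inner ℝ t x)
        rw [div_le_iff₀ (by positivity)]
        have : 2 * (1 / ((k : ℝ) + 1)) * ((k : ℝ) + 1) ^ 2 = 2 * ((k : ℝ) + 1) := by field_simp
        rw [this]
        have : (0 : ℝ) ≤ k := Nat.cast_nonneg k
        linarith
      · simpa using (tendsto_one_div_add_atTop_nhds_zero_nat (𝕜 := ℝ)).const_mul 2
  rw [integral_zero] at hlim
  have hle : ∀ k : ℕ, 0 ≤ 1 / 2 * quadForm Q t + ∫ x, (1 - Real.cos (((k : ℝ) + 1) * inner ℝ t x))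
      / ((k : ℝ) + 1) ^ 2 ∂φ := by
    intro k
    have hk : (0 : ℝ) < ((k : ℝ) + 1) ^ 2 := by positivity
    have h1 := h (((k : ℝ) + 1) • t)
    rw [Complex.norm_exp, Real.exp_le_one_iff, hφ.levyExponent_re, ← quadForm, quadForm_smul] at h1
    simp only [real_inner_smul_left] at h1
    rw [integral_div]
    have h2 : 0 ≤ (1 / 2 * quadForm Q t + (∫ x, (1 - Real.cos (((k : ℝ) + 1) * inner ℝ t x)) ∂φ)
      / ((k : ℝ) + 1) ^ 2) * ((k : ℝ) + 1) ^ 2 := by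
      rw [add_mul, div_mul_cancel₀ _ hk.ne']
      linarith
    exact nonneg_of_mul_nonneg_left h2 hk
  have := ge_of_tendsto' (hlim.const_add (1 / 2 * quadForm Q t)) hle
  linarith

/-- Convergence of `n g n` forces `g n → 0`, and `n log(1 + g n)` differs from `n g n` by at most
`‖n g n‖ ‖g n‖` eventually. The filter is any one below `atTop`, so that an ultrafilter is allowed.
-/
lemma tendsto_one_add_pow_exp_of_le_atTop {l : Filter ℕ} (hl : l ≤ atTop) {g : ℕ → ℂ} {z : ℂ}
    (hg : Tendsto (fun n : ℕ => (n : ℂ) * g n) l (𝓝 z)) :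
    Tendsto (fun n => (1 + g n) ^ n) l (𝓝 (Complex.exp z)) := by
  have hn0 : ∀ᶠ n : ℕ in l, n ≠ 0 := hl (eventually_ne_atTop 0)
  have hg0 : Tendsto g l (𝓝 0) := by
    have h1 : Tendsto (fun n : ℕ => (n : ℂ)⁻¹) l (𝓝 0) :=
      (tendsto_inv_atTop_nhds_zero_nat (𝕜 := ℂ)).mono_left hl
    have h2 := h1.mul hg
    rw [zero_mul] at h2
    refine h2.congr' ?_
    filter_upwards [hn0] with n hn
    have : (n : ℂ) ≠ 0 := by exact_mod_cast hn
    field_simp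
  have hsmall : ∀ᶠ n in l, ‖g n‖ ≤ 1 / 2 := by
    have := hg0.norm
    rw [norm_zero] at this
    exact this.eventually_le_const (by norm_num)
  have hdiff : Tendsto (fun n : ℕ => (n : ℂ) * (Complex.log (1 + g n) - g n)) l (𝓝 0) := by
    refine squeeze_zero_norm' (a := fun n : ℕ => ‖(n : ℂ) * g n‖ * ‖g n‖) ?_ ?_
    · filter_upwards [hsmall] with n hn
      have h1 := Complex.norm_log_one_add_sub_self_le (z := g n) (by linarith)
      have h2 : (1 - ‖g n‖)⁻¹ ≤ 2 := by
        rw [inv_le_comm₀ (by linarith) (by norm_num)]; linarith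
      have h3 : ‖Complex.log (1 + g n) - g n‖ ≤ ‖g n‖ * ‖g n‖ := by
        refine h1.trans ?_
        nlinarith [sq_nonneg ‖g n‖]
      rw [norm_mul, norm_mul, mul_assoc]
      gcongr
    · have h := hg.norm.mul hg0.norm
      rwa [norm_zero, mul_zero] at h
  have hlog : Tendsto (fun n : ℕ => (n : ℂ) * Complex.log (1 + g n)) l (𝓝 z) := by
    have := hdiff.add hg
    rw [zero_add] at this
    exact this.congr fun n => by ring
  refine ((Complex.continuous_exp.tendsto z).comp hlog).congr' ?_
  filter_upwards [hsmall] with n hn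
  rw [Function.comp_apply, Complex.exp_nat_mul, Complex.exp_log]
  intro h0
  have : g n = -1 := by linear_combination h0
  rw [this] at hn
  norm_num at hn

lemma isProbabilityMeasure_convPower (ν : Measure (RVec m)) [IsProbabilityMeasure ν] (n : ℕ) :
    IsProbabilityMeasure (convPower ν n) := by
  induction n with
  | zero => exact Measure.dirac.isProbabilityMeasure
  | succ n ih => unfold convPower; infer_instance

lemma charFun_convPower (ν : Measure (RVec m)) [IsProbabilityMeasure ν] (n : ℕ) (t : RVec m) :
    charFun (convPower ν n) t = charFun ν t ^ n := by
  induction n with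
  | zero => simp [convPower]
  | succ n ih =>
    have := isProbabilityMeasure_convPower ν n
    rw [convPower, charFun_conv, ih, pow_succ]

lemma norm_exp_div_sub_one_le {w : ℂ} (hw : ‖w‖ ≤ 1) {n : ℕ} (hn : 1 ≤ n) :
    (n : ℝ) * ‖Complex.exp (w / n) - 1‖ ≤ 2 * ‖w‖ := by
  have hn' : (1 : ℝ) ≤ n := by exact_mod_cast hn
  have h1 : ‖w / n‖ ≤ 1 := by
    rw [norm_div, Complex.norm_natCast]
    exact div_le_one_of_le₀ (hw.trans hn') (by positivity)
  have h2 := Complex.norm_exp_sub_one_le h1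
  rw [norm_div, Complex.norm_natCast] at h2
  calc (n : ℝ) * ‖Complex.exp (w / n) - 1‖ ≤ n * (2 * (‖w‖ / n)) := by gcongr
    _ = 2 * ‖w‖ := by field_simp

/-- Near the origin the characteristic function of an `n`-th convolution root is the principal
`n`-th root, and therefore is within `O(1/n)` of `1`. -/
lemma mul_norm_charFun_sub_one_le {μ ν : Measure (RVec m)} [IsProbabilityMeasure μ]
    [IsProbabilityMeasure ν] {n : ℕ} (hn : 1 ≤ n) (h : ∀ t, charFun μ t = charFun ν t ^ n)
    {r : ℝ} (hr : ∀ t, ‖t‖ ≤ r → ‖charFun μ t - 1‖ ≤ 1 / 2) {t : RVec m} (ht : ‖t‖ ≤ r) :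
    (n : ℝ) * ‖charFun ν t - 1‖ ≤ 3 * ‖charFun μ t - 1‖ := by
  have hcμ : Continuous (charFun μ) := continuous_charFun
  have hcν : Continuous (charFun ν) := continuous_charFun
  have hslit : ∀ s ∈ Metric.closedBall (0 : RVec m) r, charFun μ s ∈ Complex.slitPlane := by
    intro s hs
    have h1 := hr s (by simpa using hs)
    have := Complex.mem_slitPlane_of_norm_lt_one (z := charFun μ s - 1) (by linarith)
    simpa using this
  have hn0 : (n : ℂ) ≠ 0 := by exact_mod_cast (by omega : n ≠ 0)
  have hr0 : 0 ≤ r := (norm_nonneg t).trans ht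
  -- The quotient of `charFun ν` by the principal root is an `n`-th root of unity. It is continuous
  -- on a connected ball, has values in a finite set and equals `1` at `0`, hence is constantly `1`.
  let f : RVec m → ℂ := fun s => charFun ν s * Complex.exp (-(Complex.log (charFun μ s) / n))
  have hf : ContinuousOn f (Metric.closedBall 0 r) := by
    refine hcν.continuousOn.mul (Complex.continuous_exp.comp_continuousOn ?_)
    exact ((hcμ.continuousOn.clog hslit).div_const _).neg
  have hfin : {z : ℂ | z ^ n = 1}.Finite := by
    refine (Polynomial.nthRoots n (1 : ℂ)).toFinset.finite_toSet.subset fun z hz => ?_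
    simpa [Polynomial.mem_nthRoots (show 0 < n by omega)] using hz
  have hmaps : Set.MapsTo f (Metric.closedBall 0 r) {z : ℂ | z ^ n = 1} := by
    intro s hs
    simp only [Set.mem_ofPred_eq, f]
    rw [mul_pow, ← h, ← Complex.exp_nat_mul, mul_neg, mul_div_cancel₀ _ hn0, Complex.exp_neg,
      Complex.exp_log (Complex.slitPlane_ne_zero (hslit s hs)),
      mul_inv_cancel₀ (Complex.slitPlane_ne_zero (hslit s hs))]
  have hconst := (convex_closedBall (0 : RVec m) r).isPreconnected.constant_of_mapsTo
    hfin.isDiscrete hf hmaps (x := t) (y := 0) (by simpa using ht) (by simpa using hr0)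
  have hroot : charFun ν t = Complex.exp (Complex.log (charFun μ t) / n) := by
    have h0 : f 0 = 1 := by simp [f]
    rw [h0] at hconst
    simp only [f, Complex.exp_neg] at hconst
    rw [← div_eq_mul_inv, div_eq_one_iff_eq (Complex.exp_ne_zero _)] at hconst
    exact hconst
  have hlog := Complex.norm_log_one_add_half_le_self (hr t ht)
  rw [add_sub_cancel] at hlog
  rw [hroot]
  refine (norm_exp_div_sub_one_le ?_ hn).trans ?_
  · linarith [hr t ht]
  · linarith

lemma lintegral_one_sub_cos_eq (ν : Measure (RVec m)) [IsProbabilityMeasure ν] (t : RVec m) :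
    ∫⁻ x, ENNReal.ofReal (1 - Real.cos (inner ℝ t x)) ∂ν
      = ENNReal.ofReal (1 - (charFun ν t).re) := by
  have hint : Integrable (fun x : RVec m => Complex.exp ((inner ℝ x t : ℝ) * Complex.I)) ν :=
    Integrable.of_bound (Continuous.aestronglyMeasurable (by fun_prop)) 1
      (ae_of_all _ fun x => by rw [Complex.norm_exp_ofReal_mul_I])
  have hre := integral_re hint
  simp only [RCLike.re_eq_complex_re, Complex.exp_ofReal_mul_I_re] at hre
  have hcos : Integrable (fun x : RVec m => Real.cos (inner ℝ t x)) ν := by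
    refine hint.re.congr (ae_of_all _ fun x => ?_)
    simp [Complex.exp_ofReal_mul_I_re, real_inner_comm]
  have hsub : Integrable (fun x : RVec m => 1 - Real.cos (inner ℝ t x)) ν :=
    (integrable_const _).sub hcos
  rw [charFun_apply, ← hre, ← ofReal_integral_eq_lintegral_ofReal hsub
    (ae_of_all _ fun x => sub_nonneg.2 (Real.cos_le_one _)), integral_sub (integrable_const _) hcos]
  simp [real_inner_comm]

/-- With `g n = charFun (ν n) t - 1` for an `n`-th convolution root `ν n`, the compound Poisson
exponent with jump measure `n • ν n` is `n g n`, while `(1 + g n) ^ n = charFun μ t`. A limit of the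
exponents therefore exponentiates to `charFun μ`. The compactness hypotheses follow from
`mul_norm_charFun_sub_one_le` near the origin and truncation. -/
theorem IsInfDivisible.exists_hasLevyTriplet {μ : Measure (RVec m)} [IsProbabilityMeasure μ]
    (hμ : IsInfDivisible μ) : ∃ γ Q φ, HasLevyTriplet μ γ Q φ := by
  have hroot : ∀ n : ℕ, ∃ ν : Measure (RVec m), IsProbabilityMeasure ν ∧
      (1 ≤ n → ∀ t, charFun μ t = charFun ν t ^ n) := by
    intro n
    rcases Nat.lt_or_ge n 1 with hn | hn
    · exact ⟨μ, inferInstance, fun h => absurd h (by omega)⟩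
    · obtain ⟨ν, hν, hνμ⟩ := hμ n hn
      exact ⟨ν, hν, fun _ t => by rw [← hνμ, charFun_convPower]⟩
  choose ν hν hνμ using hroot
  have hcμ : Continuous (charFun μ) := continuous_charFun
  have hnear : ∀ ε : ℝ, 0 < ε → ∃ r : ℝ, 0 < r ∧ r ≤ 1 ∧
      ∀ t, ‖t‖ ≤ r → ‖charFun μ t - 1‖ ≤ ε := by
    intro ε hε
    have h1 : Tendsto (charFun μ) (𝓝 0) (𝓝 1) := by simpa using hcμ.tendsto 0
    obtain ⟨r, hr, h⟩ := Metric.tendsto_nhds_nhds.1 h1 ε hε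
    refine ⟨min (r / 2) 1, by positivity, min_le_right _ _, fun t ht => ?_⟩
    have h2 : dist t 0 < r := by
      rw [dist_zero_right]
      have := ht.trans (min_le_left _ _)
      linarith
    simpa [dist_eq_norm] using (h h2).le
  obtain ⟨r₀, hr₀, hr₀1, hr₀'⟩ := hnear (1 / 2) (by norm_num)
  let φ : ℕ → Measure (RVec m) := fun n => (n : ℝ≥0∞) • ν n
  have hφfin : ∀ n, IsFiniteMeasure (φ n) := fun n =>
    Measure.smul_finite _ (ENNReal.natCast_ne_top n)
  have hcharφ : ∀ n t, ∫ x, (Complex.exp (Complex.I * ((inner ℝ t x : ℝ) : ℂ)) - 1) ∂(φ n)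
      = (n : ℂ) * (charFun (ν n) t - 1) := by
    intro n t
    have hint : Integrable (fun x : RVec m => Complex.exp (Complex.I * ((inner ℝ t x : ℝ) : ℂ)))
        (ν n) :=
      Integrable.of_bound (Continuous.aestronglyMeasurable (by fun_prop)) 1
        (ae_of_all _ fun x => by rw [mul_comm, Complex.norm_exp_ofReal_mul_I])
    rw [integral_smul_measure, integral_sub hint (integrable_const _), charFun_apply]
    simp [mul_comm Complex.I, real_inner_comm]
  have hcos : ∀ (r ε : ℝ), r ≤ r₀ → (∀ t, ‖t‖ ≤ r → ‖charFun μ t - 1‖ ≤ ε) → ∀ n t, ‖t‖ ≤ r →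
      ∫⁻ x, ENNReal.ofReal (1 - Real.cos (inner ℝ t x)) ∂(φ n) ≤ ENNReal.ofReal (3 * ε) := by
    intro r ε hr h n t ht
    have hε : 0 ≤ ε := (norm_nonneg _).trans (h t ht)
    rcases Nat.lt_or_ge n 1 with hn | hn
    · have : n = 0 := by omega
      subst this
      simp [φ]
    rw [lintegral_smul_measure, lintegral_one_sub_cos_eq, smul_eq_mul,
      ← ENNReal.ofReal_natCast n, ← ENNReal.ofReal_mul (Nat.cast_nonneg n)]
    refine ENNReal.ofReal_le_ofReal ?_
    have h1 := mul_norm_charFun_sub_one_le hn (hνμ n hn) hr₀' (ht.trans hr)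
    have h2 : 1 - (charFun (ν n) t).re ≤ ‖charFun (ν n) t - 1‖ := by
      have := Complex.re_le_norm (1 - charFun (ν n) t)
      rwa [norm_sub_rev, Complex.sub_re, Complex.one_re] at this
    calc (n : ℝ) * (1 - (charFun (ν n) t).re) ≤ n * ‖charFun (ν n) t - 1‖ := by gcongr
      _ ≤ 3 * ‖charFun μ t - 1‖ := h1
      _ ≤ 3 * ε := by linarith [h t ht]
  have htrunc : ∀ (r ε : ℝ), 0 ≤ r → r ≤ r₀ → (∀ t, ‖t‖ ≤ r → ‖charFun μ t - 1‖ ≤ ε) → ∀ n,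
      ∫⁻ x, ENNReal.ofReal (min 1 ((r * ‖x‖) ^ 2)) ∂(φ n)
        ≤ ENNReal.ofReal (60 * m * ε) := by
    intro r ε hr0 hr h n
    have hε : 0 ≤ ε := (norm_nonneg _).trans (h 0 (by simpa using hr0))
    refine (lintegral_min_one_sq_le (φ n) hr0 (hcos r ε hr h n)).trans (le_of_eq ?_)
    rw [show 60 * (m : ℝ) * ε = 20 * m * (3 * ε) by ring,
      ENNReal.ofReal_mul (by positivity), ENNReal.ofReal_mul (by norm_num)]
    simp
  have htight : ∀ ε : ℝ, 0 < ε → ∃ R : ℝ, ∀ n,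
      φ n (Metric.closedBall 0 R)ᶜ ≤ ENNReal.ofReal ε := by
    intro ε hε
    -- `60 m` is the constant of `htrunc`; `m + 1` keeps the denominator positive when `m = 0`.
    -- Outside the ball of radius `1 / min r r₀` the truncated weight equals `1`.
    obtain ⟨r, hr0, -, hr⟩ := hnear (ε / (60 * (m + 1))) (by positivity)
    refine ⟨1 / min r r₀, fun n => ?_⟩
    have hr' : 0 < min r r₀ := lt_min hr0 hr₀
    calc φ n (Metric.closedBall 0 (1 / min r r₀))ᶜ
        ≤ φ n {x | 1 ≤ ENNReal.ofReal (min 1 ((min r r₀ * ‖x‖) ^ 2))} := by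
          refine measure_mono fun x hx => ?_
          simp only [Set.mem_compl_iff, Metric.mem_closedBall, dist_zero_right, not_le] at hx
          rw [div_lt_iff₀ hr', mul_comm] at hx
          simp only [Set.mem_ofPred_eq]
          rw [min_eq_left (by nlinarith), ENNReal.ofReal_one]
      _ ≤ ∫⁻ x, ENNReal.ofReal (min 1 ((min r r₀ * ‖x‖) ^ 2)) ∂(φ n) := by
          have := mul_meas_ge_le_lintegral₀ (μ := φ n)
            (f := fun x : RVec m => ENNReal.ofReal (min 1 ((min r r₀ * ‖x‖) ^ 2)))
            (ENNReal.continuous_ofReal.comp (by fun_prop)).aemeasurable 1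
          rwa [one_mul] at this
      _ ≤ ENNReal.ofReal (60 * m * (ε / (60 * (m + 1)))) :=
          htrunc _ _ hr'.le (min_le_right _ _) (fun t ht => hr t (ht.trans (min_le_left _ _))) n
      _ ≤ ENNReal.ofReal ε := by
          refine ENNReal.ofReal_le_ofReal ?_
          rw [mul_div_assoc', div_le_iff₀ (by positivity)]
          nlinarith
  let C₁ : ℝ := 1 / r₀ ^ 2 * (60 * m * (1 / 2))
  have hmass : ∀ n, minSqIntegral (φ n) ≤ ENNReal.ofReal C₁ := by
    intro n
    have h1 : ∀ x : RVec m, minSq x ≤ 1 / r₀ ^ 2 * min 1 ((r₀ * ‖x‖) ^ 2) := by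
      intro x
      have hr2 : 0 < r₀ ^ 2 := by positivity
      rw [one_div, ← div_eq_inv_mul, le_div_iff₀ hr2]
      refine le_min ?_ ?_
      · have := minSq_le_one x
        have := minSq_nonneg x
        have : r₀ ^ 2 ≤ 1 := by nlinarith
        nlinarith
      · rw [mul_pow, mul_comm]
        gcongr
        exact minSq_le_sq x
    calc minSqIntegral (φ n)
        ≤ ∫⁻ x, ENNReal.ofReal (1 / r₀ ^ 2) * ENNReal.ofReal (min 1 ((r₀ * ‖x‖) ^ 2)) ∂(φ n) :=
          lintegral_mono fun x => by
            rw [← ENNReal.ofReal_mul (by positivity)]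
            exact ENNReal.ofReal_le_ofReal (h1 x)
      _ = ENNReal.ofReal (1 / r₀ ^ 2) * ∫⁻ x, ENNReal.ofReal (min 1 ((r₀ * ‖x‖) ^ 2)) ∂(φ n) :=
          lintegral_const_mul _ (ENNReal.continuous_ofReal.comp (by fun_prop)).measurable
      _ ≤ ENNReal.ofReal (1 / r₀ ^ 2) * ENNReal.ofReal (60 * m * (1 / 2)) := by
          gcongr
          exact htrunc r₀ _ hr₀.le le_rfl hr₀' n
      _ = ENNReal.ofReal C₁ := by rw [← ENNReal.ofReal_mul (by positivity)]
  have hC₁ : 0 ≤ C₁ := by positivity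
  have hdrift : ∀ n, ‖drift (φ n)‖ ≤ (2 + kernelBound r₀ * C₁) / r₀ := by
    intro n
    have hkb : 0 ≤ kernelBound r₀ := by unfold kernelBound; positivity
    have hint : Integrable (minSq (m := m)) (φ n) :=
      Integrable.of_bound continuous_minSq.aestronglyMeasurable 1 (ae_of_all _ fun x => by
        rw [Real.norm_of_nonneg (minSq_nonneg x)]; exact minSq_le_one x)
    have hmin : ∫ x, minSq x ∂(φ n) ≤ C₁ := by
      rw [integral_eq_lintegral_of_nonneg_ae (ae_of_all _ minSq_nonneg) hint.1]
      refine (ENNReal.toReal_mono ENNReal.ofReal_ne_top (hmass n)).trans ?_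
      rw [ENNReal.toReal_ofReal hC₁]
    -- The drift term is the whole exponent minus the kernel integral, and near the origin both are
    -- bounded uniformly in `n`.
    have h1 : ∀ t : RVec m, ‖t‖ ≤ r₀ → |(inner ℝ (drift (φ n)) t : ℝ)| ≤ 2 + kernelBound r₀ * C₁ := by
      intro t ht
      have h2 := integral_exp_sub_one_eq (φ n) t
      have h3 : ‖∫ x, levyKernel t x ∂(φ n)‖ ≤ kernelBound r₀ * C₁ := by
        refine (norm_integral_le_of_norm_le (hint.const_mul _)
          (ae_of_all _ fun x => norm_levyKernel_le ht x)).trans ?_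
        rw [integral_const_mul]
        gcongr
      have h4 : ‖(n : ℂ) * (charFun (ν n) t - 1)‖ ≤ 2 := by
        rcases Nat.lt_or_ge n 1 with hn | hn
        · have : n = 0 := by omega
          simp [this]
        · rw [norm_mul, Complex.norm_natCast]
          have := mul_norm_charFun_sub_one_le hn (hνμ n hn) hr₀' ht
          linarith [hr₀' t ht]
      rw [hcharφ] at h2
      have h5 : Complex.I * ((inner ℝ (drift (φ n)) t : ℝ) : ℂ)
          = (n : ℂ) * (charFun (ν n) t - 1) - ∫ x, levyKernel t x ∂(φ n) := by rw [h2]; ring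
      have h6 : |(inner ℝ (drift (φ n)) t : ℝ)|
          = ‖Complex.I * ((inner ℝ (drift (φ n)) t : ℝ) : ℂ)‖ := by
        rw [norm_mul, Complex.norm_I, one_mul, Complex.norm_real, Real.norm_eq_abs]
      rw [h6, h5]
      exact (norm_sub_le _ _).trans (add_le_add h4 h3)
    rcases eq_or_ne (drift (φ n)) 0 with h0 | h0
    · rw [h0, norm_zero]; positivity
    have hpos := norm_pos_iff.2 h0
    -- Testing with the multiple of the drift of length `r₀` recovers its norm.
    have h7 := h1 ((r₀ / ‖drift (φ n)‖) • drift (φ n)) (by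
      rw [norm_smul, Real.norm_of_nonneg (by positivity), div_mul_cancel₀ _ hpos.ne'])
    rw [real_inner_smul_right, real_inner_self_eq_norm_sq, abs_of_nonneg (by positivity)] at h7
    rw [le_div_iff₀ hr₀]
    refine le_trans (le_of_eq ?_) h7
    field_simp
  let C : ℝ := max C₁ ((2 + kernelBound r₀ * C₁) / r₀)
  obtain ⟨γ, Q, ψ, hQ, hψ, hlim⟩ := exists_tendsto_levyExponent (hyperfilter ℕ) φ (C := C)
    (fun n => (hmass n).trans (ENNReal.ofReal_le_ofReal (le_max_left _ _))) htight
    (fun n => (hdrift n).trans (le_max_right _ _))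
  have hexp : ∀ t, charFun μ t = Complex.exp (levyExponent γ Q ψ t) := by
    intro t
    have hle : (hyperfilter ℕ : Filter ℕ) ≤ atTop := by
      rw [← Nat.cofinite_eq_atTop]; exact hyperfilter_le_cofinite
    have h1 := hlim t
    simp only [hcharφ] at h1
    have h2 := tendsto_one_add_pow_exp_of_le_atTop hle h1
    refine tendsto_nhds_unique (l := (hyperfilter ℕ : Filter ℕ)) ?_ h2
    refine tendsto_const_nhds.congr' ?_
    filter_upwards [hle (eventually_ge_atTop 1)] with n hn
    rw [hνμ n hn t, add_sub_cancel]
  refine ⟨γ, Q, ψ, ?_, hψ, hexp⟩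
  refine posSemidef_of_norm_exp_levyExponent_le_one hψ γ hQ fun t => ?_
  rw [← hexp]
  exact norm_charFun_le_one t

end Existence

/-! ### Convergence to the point mass at the origin in terms of the triplet. -/

section SmallLaws

variable {m : ℕ}

lemma norm_charFun_map_sub_one_le {Ω : Type*} [MeasurableSpace Ω] (P : Measure Ω)
    [IsProbabilityMeasure P] {X : Ω → RVec m} (hX : Measurable X) {R ε : ℝ} (hε : 0 < ε)
    {t : RVec m} (ht : ‖t‖ ≤ R) :
    ‖charFun (P.map X) t - 1‖ ≤ R * ε + 2 * P.real {ω | ε ≤ ‖X ω‖} := by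
  have hR : 0 ≤ R := (norm_nonneg t).trans ht
  have hmeas : Measurable fun ω => Complex.exp ((inner ℝ (X ω) t : ℝ) * Complex.I) := by
    have : Continuous fun x : RVec m => Complex.exp ((inner ℝ x t : ℝ) * Complex.I) := by fun_prop
    exact this.measurable.comp hX
  have hint : Integrable (fun ω => Complex.exp ((inner ℝ (X ω) t : ℝ) * Complex.I)) P :=
    Integrable.of_bound hmeas.aestronglyMeasurable 1
      (ae_of_all _ fun ω => by rw [Complex.norm_exp_ofReal_mul_I])
  have hset : MeasurableSet {ω | ε ≤ ‖X ω‖} := measurableSet_le measurable_const hX.norm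
  have h1 : charFun (P.map X) t - 1
      = ∫ ω, (Complex.exp ((inner ℝ (X ω) t : ℝ) * Complex.I) - 1) ∂P := by
    rw [charFun_apply, integral_map hX.aemeasurable
      (Continuous.aestronglyMeasurable (by fun_prop)), integral_sub hint (integrable_const _)]
    simp
  have hi : Integrable ({ω | ε ≤ ‖X ω‖}.indicator fun _ => (2 : ℝ)) P :=
    (integrable_const _).indicator hset
  rw [h1]
  refine (norm_integral_le_of_norm_le (g := fun ω => R * ε + {ω | ε ≤ ‖X ω‖}.indicator
    (fun _ => (2 : ℝ)) ω) ((integrable_const _).add hi) (ae_of_all _ fun ω => ?_)).trans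
    (le_of_eq ?_)
  · rw [mul_comm ((inner ℝ (X ω) t : ℝ) : ℂ)]
    by_cases hω : ε ≤ ‖X ω‖
    · rw [Set.indicator_of_mem (by exact hω)]
      have := norm_exp_I_mul_sub_one_le_two (inner ℝ (X ω) t)
      have : 0 ≤ R * ε := by positivity
      linarith
    · rw [Set.indicator_of_notMem (by exact hω), add_zero]
      refine (Real.norm_exp_I_mul_ofReal_sub_one_le).trans ?_
      rw [real_inner_comm, Real.norm_eq_abs]
      refine (abs_inner_le_mul_norm ht _).trans ?_
      gcongr
      exact (not_le.1 hω).le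
  · rw [integral_add (integrable_const _) hi, integral_indicator hset]
    simp [mul_comm, measureReal_def]

lemma MeasureTheory.TendstoInMeasure.eventually_norm_charFun_sub_one_le {Ω : Type*}
    [MeasurableSpace Ω]
    {P : Measure Ω} [IsProbabilityMeasure P] {X : ℕ → Ω → RVec m} (hX : ∀ n, Measurable (X n))
    (h : TendstoInMeasure P X atTop fun _ => 0) (R : ℝ) {δ : ℝ} (hδ : 0 < δ) :
    ∀ᶠ n in atTop, ∀ t : RVec m, ‖t‖ ≤ R → ‖charFun (P.map (X n)) t - 1‖ ≤ δ := by
  have hε : 0 < δ / (2 * (|R| + 1)) := by positivity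
  have h1 := tendstoInMeasure_iff_norm.1 h _ hε
  have h2 := (ENNReal.tendsto_toReal ENNReal.zero_ne_top).comp h1
  filter_upwards [h2.eventually_le_const (show (0 : ℝ≥0∞).toReal < δ / 4 by simpa using by positivity)]
    with n hn t ht
  refine (norm_charFun_map_sub_one_le P (hX n) hε ht).trans ?_
  simp only [Function.comp_apply, sub_zero] at hn
  have h3 : R * (δ / (2 * (|R| + 1))) ≤ δ / 2 := by
    rw [mul_div_assoc', div_le_div_iff₀ (by positivity) two_pos]
    nlinarith [le_abs_self R]
  rw [measureReal_def]
  linarith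

lemma MeasureTheory.TendstoInMeasure.tendsto_charFun {Ω : Type*} [MeasurableSpace Ω]
    {P : Measure Ω} [IsProbabilityMeasure P] {X : ℕ → Ω → RVec m} (hX : ∀ n, Measurable (X n))
    (h : TendstoInMeasure P X atTop fun _ => 0) (t : RVec m) :
    Tendsto (fun n => charFun (P.map (X n)) t) atTop (𝓝 1) := by
  rw [Metric.tendsto_atTop']
  intro ε hε
  obtain ⟨N, hN⟩ := eventually_atTop.1
    (h.eventually_norm_charFun_sub_one_le hX ‖t‖ (half_pos hε))
  refine ⟨N, fun n hn => ?_⟩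
  rw [dist_eq_norm]
  exact (hN n hn.le t le_rfl).trans_lt (half_lt_self hε)

/-- Lévy's continuity theorem gives weak convergence of the laws to `δ₀`; the closed set `{ε ≤ ‖x‖}`
misses `0`, so its frontier is `δ₀`-null and its mass tends to `0`. -/
lemma tendstoInMeasure_of_tendsto_charFun {Ω : Type*} [MeasurableSpace Ω]
    {P : Measure Ω} [IsProbabilityMeasure P] {X : ℕ → Ω → RVec m} (hX : ∀ n, Measurable (X n))
    (h : ∀ t, Tendsto (fun n => charFun (P.map (X n)) t) atTop (𝓝 1)) :
    TendstoInMeasure P X atTop fun _ => 0 := by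
  have hprob : ∀ n, IsProbabilityMeasure (P.map (X n)) := fun n =>
    Measure.isProbabilityMeasure_map (hX n).aemeasurable
  let μ : ℕ → ProbabilityMeasure (RVec m) := fun n => ⟨P.map (X n), hprob n⟩
  have hlim : Tendsto μ atTop
      (𝓝 (diracProba 0)) := by
    refine ProbabilityMeasure.tendsto_of_tendsto_charFun fun t => ?_
    have : charFun ((diracProba (0 : RVec m) : ProbabilityMeasure (RVec m)) : Measure (RVec m)) t
        = 1 := by
      change charFun (Measure.dirac 0) t = 1
      simp
    rw [this]
    exact h t
  rw [tendstoInMeasure_iff_norm]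
  intro ε hε
  have hclosed : IsClosed {x : RVec m | ε ≤ ‖x‖} := isClosed_le continuous_const continuous_norm
  have hnot : (0 : RVec m) ∉ {x : RVec m | ε ≤ ‖x‖} := by simpa using hε
  have h1 := ProbabilityMeasure.tendsto_measure_of_null_frontier_of_tendsto' hlim
    (E := {x : RVec m | ε ≤ ‖x‖}) (by
      change Measure.dirac (0 : RVec m) _ = 0
      rw [Measure.dirac_apply' _ isClosed_frontier.measurableSet, Set.indicator_of_notMem]
      exact fun hx => hnot (hclosed.frontier_subset hx))
  have h2 : ((diracProba (0 : RVec m) : ProbabilityMeasure (RVec m)) : Measure (RVec m))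
      {x : RVec m | ε ≤ ‖x‖} = 0 := by
    change Measure.dirac (0 : RVec m) _ = 0
    rw [Measure.dirac_apply' _ hclosed.measurableSet, Set.indicator_of_notMem hnot]
  rw [h2] at h1
  refine h1.congr fun n => ?_
  change P.map (X n) _ = _
  rw [Measure.map_apply (hX n) hclosed.measurableSet]
  simp

/-- The contribution `tr Q + ∫ min {1, ‖x‖²} φ(dx)` of the Gaussian and the jump part. -/
def spread (Q : Matrix (Fin m) (Fin m) ℝ) (φ : Measure (RVec m)) : ℝ≥0∞ :=
  ENNReal.ofReal Q.trace + minSqIntegral φ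

lemma trace_eq_sum_quadForm (Q : Matrix (Fin m) (Fin m) ℝ) :
    Q.trace = ∑ i, quadForm Q (EuclideanSpace.single i 1) := by
  simp [Matrix.trace, quadForm_single]

/-- `‖charFun μ t‖` is the exponential of `-½⟨Q t, t⟩ - ∫ (1 - cos⟨t, x⟩) dφ`, free of `γ`. Unit
axis vectors bound the trace by `4mδ`, and truncation bounds the jump part by `40mδ`. -/
lemma HasLevyTriplet.spread_le {μ : Measure (RVec m)} {γ : RVec m} {Q : Matrix (Fin m) (Fin m) ℝ}
    {φ : Measure (RVec m)} (h : HasLevyTriplet μ γ Q φ) {δ : ℝ} (hδ : δ ≤ 1 / 2)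
    (hμ : ∀ t, ‖t‖ ≤ 1 → ‖charFun μ t - 1‖ ≤ δ) :
    spread Q φ ≤ ENNReal.ofReal (44 * m * δ) := by
  have hφ := h.isLevyMeasure
  have hδ0 : 0 ≤ δ := (norm_nonneg _).trans (hμ 0 (by simp))
  have hq := (posSemidef_iff_quadForm.1 h.posSemidef).2
  have hcos0 : ∀ t : RVec m, 0 ≤ ∫ x, (1 - Real.cos (inner ℝ t x)) ∂φ := fun t =>
    integral_nonneg fun x => sub_nonneg.2 (Real.cos_le_one _)
  have hre : ∀ t, ‖t‖ ≤ 1 →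
      1 / 2 * quadForm Q t + ∫ x, (1 - Real.cos (inner ℝ t x)) ∂φ ≤ 2 * δ := by
    intro t ht
    set g := 1 / 2 * quadForm Q t + ∫ x, (1 - Real.cos (inner ℝ t x)) ∂φ with hg
    have hnorm : ‖charFun μ t‖ = Real.exp (-g) := by
      rw [h.charFun_eq, Complex.norm_exp, hφ.levyExponent_re, ← quadForm, hg]
      congr 1
      ring
    have h1 : 1 - δ ≤ Real.exp (-g) := by
      rw [← hnorm]
      have h2 := norm_sub_norm_le (1 : ℂ) (charFun μ t)
      rw [norm_one, norm_sub_rev] at h2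
      linarith [hμ t ht]
    have h2 := Real.add_one_le_exp g
    have h3 : Real.exp (-g) * Real.exp g = 1 := by rw [← Real.exp_add]; simp
    have hg0 : 0 ≤ g := add_nonneg (mul_nonneg (by norm_num) (hq t)) (hcos0 t)
    -- `(1 - δ)(1 + g) ≤ exp(-g) exp g = 1` with `δ ≤ 1/2` gives `g ≤ 2δ`.
    have h4 := mul_le_mul h1 h2 (by linarith) (Real.exp_pos _).le
    rw [h3] at h4
    nlinarith
  have htr : Q.trace ≤ 4 * m * δ := by
    rw [trace_eq_sum_quadForm]
    calc ∑ i, quadForm Q (EuclideanSpace.single i 1) ≤ ∑ _i : Fin m, 4 * δ := by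
          refine Finset.sum_le_sum fun i _ => ?_
          have := hre (EuclideanSpace.single i 1) (by simp)
          linarith [hcos0 (EuclideanSpace.single i 1)]
      _ = 4 * m * δ := by simp; ring
  have := hφ.sigmaFinite
  have hmin : minSqIntegral φ ≤ ENNReal.ofReal (40 * m * δ) := by
    have h1 := lintegral_min_one_sq_le φ zero_le_one (K := ENNReal.ofReal (2 * δ)) fun t ht => by
      rw [← ofReal_integral_eq_lintegral_ofReal (hφ.integrable_one_sub_cos t)
        (ae_of_all _ fun x => sub_nonneg.2 (Real.cos_le_one _))]
      refine ENNReal.ofReal_le_ofReal ?_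
      linarith [hre t ht, hq t]
    simp only [one_mul] at h1
    refine h1.trans (le_of_eq ?_)
    rw [show 40 * (m : ℝ) * δ = 20 * m * (2 * δ) by ring, ENNReal.ofReal_mul (by positivity),
      ENNReal.ofReal_mul (by norm_num)]
    simp
  calc spread Q φ ≤ ENNReal.ofReal (4 * m * δ) + ENNReal.ofReal (40 * m * δ) :=
        add_le_add (ENNReal.ofReal_le_ofReal htr) hmin
    _ = ENNReal.ofReal (44 * m * δ) := by
        rw [← ENNReal.ofReal_add (by positivity) (by positivity)]
        congr 1
        ring

/-- Non-negativity of the form at `eᵢ ± eⱼ` gives `2|Q i j| ≤ Q i i + Q j j`. -/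
lemma abs_entry_le_trace {Q : Matrix (Fin m) (Fin m) ℝ} (hQ : Q.PosSemidef) (i j : Fin m) :
    |Q i j| ≤ Q.trace := by
  have hq := (posSemidef_iff_quadForm.1 hQ).2
  have hd : ∀ i, 0 ≤ Q i i := fun i => by rw [← quadForm_single Q i]; exact hq _
  have hle : ∀ i, Q i i ≤ Q.trace := fun i =>
    Finset.single_le_sum (f := fun i => Q i i) (fun j _ => hd j) (Finset.mem_univ i)
  have hsymm : Q j i = Q i j := by simpa using hQ.1.apply i j
  have h1 := hq (EuclideanSpace.single i 1 + EuclideanSpace.single j 1)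
  have h2 := quadForm_second_difference Q (EuclideanSpace.single i 1) (EuclideanSpace.single j 1)
  have h3 := hq (EuclideanSpace.single i 1 - EuclideanSpace.single j 1)
  rw [quadForm_single_add] at h1 h2
  rw [quadForm_single, quadForm_single] at h2
  rw [abs_le]
  constructor <;> linarith [hle i, hle j]

lemma quadForm_le_trace {Q : Matrix (Fin m) (Fin m) ℝ} (hQ : Q.PosSemidef) (t : RVec m) :
    quadForm Q t ≤ Q.trace * (m ^ 2 * ‖t‖ ^ 2) := by
  rw [quadForm_eq_sum]
  calc ∑ i, ∑ j, Q i j * (t i * t j) ≤ ∑ _i : Fin m, ∑ _j : Fin m, Q.trace * ‖t‖ ^ 2 := by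
        refine Finset.sum_le_sum fun i _ => Finset.sum_le_sum fun j _ => ?_
        refine (le_abs_self _).trans ?_
        rw [abs_mul]
        exact mul_le_mul (abs_entry_le_trace hQ i j) (abs_coord_mul_coord_le t i j) (abs_nonneg _)
          ((abs_nonneg _).trans (abs_entry_le_trace hQ i j))
    _ = Q.trace * (m ^ 2 * ‖t‖ ^ 2) := by simp; ring

lemma norm_levyExponent_sub_le {Q : Matrix (Fin m) (Fin m) ℝ} {φ : Measure (RVec m)}
    (hQ : Q.PosSemidef) (hφ : IsLevyMeasure φ) (γ t : RVec m) :
    ‖levyExponent γ Q φ t - Complex.I * ((inner ℝ γ t : ℝ) : ℂ)‖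
      ≤ (m ^ 2 * ‖t‖ ^ 2 + kernelBound ‖t‖) * (spread Q φ).toReal := by
  have htr : 0 ≤ Q.trace := hQ.trace_nonneg
  have hkb : 0 ≤ kernelBound ‖t‖ := by unfold kernelBound; positivity
  have hspread : (spread Q φ).toReal = Q.trace + ∫ x, minSq x ∂φ := by
    rw [spread, ← hφ.ofReal_integral_minSq, ← ENNReal.ofReal_add htr
      (integral_nonneg minSq_nonneg), ENNReal.toReal_ofReal]
    exact add_nonneg htr (integral_nonneg minSq_nonneg)
  have hmin : 0 ≤ ∫ x, minSq x ∂φ := integral_nonneg minSq_nonneg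
  have hq0 := (posSemidef_iff_quadForm.1 hQ).2 t
  have h1 : levyExponent γ Q φ t - Complex.I * ((inner ℝ γ t : ℝ) : ℂ)
      = ∫ x, levyKernel t x ∂φ - (((1 / 2) * quadForm Q t : ℝ) : ℂ) := by
    rw [levyExponent_eq, quadForm]
    push_cast
    ring
  rw [h1, hspread]
  refine (norm_sub_le _ _).trans ?_
  rw [Complex.norm_real, Real.norm_of_nonneg (by positivity)]
  have h2 := hφ.norm_integral_levyKernel_le t
  have h3 := quadForm_le_trace hQ t
  have h4 : 0 ≤ (m : ℝ) ^ 2 * ‖t‖ ^ 2 := by positivity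
  nlinarith [mul_nonneg hkb htr, mul_nonneg h4 hmin, mul_nonneg htr h4]

variable {μ : ℕ → Measure (RVec m)} {γ : ℕ → RVec m} {Q : ℕ → Matrix (Fin m) (Fin m) ℝ}
  {φ : ℕ → Measure (RVec m)}

lemma tendsto_levyExponent_sub (h : ∀ n, HasLevyTriplet (μ n) (γ n) (Q n) (φ n))
    (hs : Tendsto (fun n => spread (Q n) (φ n)) atTop (𝓝 0)) (t : RVec m) :
    Tendsto (fun n => levyExponent (γ n) (Q n) (φ n) t
      - Complex.I * ((inner ℝ (γ n) t : ℝ) : ℂ)) atTop (𝓝 0) := by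
  refine squeeze_zero_norm (fun n =>
    norm_levyExponent_sub_le (h n).posSemidef (h n).isLevyMeasure (γ n) t) ?_
  have h1 := (ENNReal.tendsto_toReal ENNReal.zero_ne_top).comp hs
  have h2 := h1.const_mul (m ^ 2 * ‖t‖ ^ 2 + kernelBound ‖t‖)
  simpa [Function.comp_def] using h2

lemma tendsto_charFun_one_of_triplet (h : ∀ n, HasLevyTriplet (μ n) (γ n) (Q n) (φ n))
    (hs : Tendsto (fun n => spread (Q n) (φ n)) atTop (𝓝 0)) (hγ : Tendsto γ atTop (𝓝 0))
    (t : RVec m) : Tendsto (fun n => charFun (μ n) t) atTop (𝓝 1) := by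
  have h1 : Tendsto (fun n => Complex.I * ((inner ℝ (γ n) t : ℝ) : ℂ)) atTop (𝓝 0) := by
    have h2 : Tendsto (fun n => (inner ℝ (γ n) t : ℝ)) atTop (𝓝 0) := by
      simpa using hγ.inner (tendsto_const_nhds (x := t))
    have h3 := ((Complex.continuous_ofReal.tendsto 0).comp h2).const_mul Complex.I
    simpa [Function.comp_def] using h3
  have h2 := (tendsto_levyExponent_sub h hs t).add h1
  simp only [sub_add_cancel, add_zero] at h2
  have h3 := (Complex.continuous_exp.tendsto 0).comp h2
  rw [Complex.exp_zero] at h3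
  exact h3.congr fun n => ((h n).charFun_eq t).symm

/-- Dividing out the vanishing part of the exponent leaves `exp(i⟨γ n, t⟩) → 1` for each `t`. To
exclude wrapping around the circle, this is read as convergence of the characteristic functions of
the point masses at `γ n`, whose weak convergence is convergence of the points. -/
lemma tendsto_drift_zero_of_triplet (h : ∀ n, HasLevyTriplet (μ n) (γ n) (Q n) (φ n))
    (hs : Tendsto (fun n => spread (Q n) (φ n)) atTop (𝓝 0))
    (hμ : ∀ t, Tendsto (fun n => charFun (μ n) t) atTop (𝓝 1)) : Tendsto γ atTop (𝓝 0) := by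
  refine (tendsto_diracProba_iff_tendsto (map γ atTop)).1 (tendsto_map'_iff.2 ?_)
  refine ProbabilityMeasure.tendsto_of_tendsto_charFun fun t => ?_
  have h0 : ∀ x : RVec m, charFun ((diracProba x : ProbabilityMeasure (RVec m)) :
      Measure (RVec m)) t = Complex.exp (Complex.I * ((inner ℝ x t : ℝ) : ℂ)) := fun x => by
    change charFun (Measure.dirac x) t = _
    rw [charFun_dirac, mul_comm]
  simp only [Function.comp_apply, h0]
  have h1 := ((Complex.continuous_exp.tendsto _).comp (tendsto_levyExponent_sub h hs t).neg).mul
    (hμ t)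
  simp only [neg_zero, Complex.exp_zero, mul_one, Function.comp_apply] at h1
  rw [inner_zero_left, Complex.ofReal_zero, mul_zero, Complex.exp_zero]
  refine h1.congr fun n => ?_
  rw [(h n).charFun_eq, ← Complex.exp_add]
  congr 1
  ring

end SmallLaws

/-! ### Continuous charges on a `δ`-ring, their total variation and extension. -/

section Charges

variable {S : Type*} {𝒮 : Set (Set S)} {m : ℕ}

lemma IsDeltaRing.iUnion_mem_of_subset (h𝒮 : IsDeltaRing 𝒮) {A : Set S} (hA : A ∈ 𝒮)
    {B : ℕ → Set S} (hB : ∀ n, B n ∈ 𝒮) (hBA : ∀ n, B n ⊆ A) : ⋃ n, B n ∈ 𝒮 := by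
  have h : ⋃ n, B n = A \ ⋂ n, A \ B n := by
    ext x
    simp only [Set.mem_iUnion, Set.mem_sdiff, Set.mem_iInter, not_forall, not_and, not_not]
    exact ⟨fun ⟨n, hn⟩ => ⟨hBA n hn, n, fun _ => hn⟩, fun ⟨hx, n, hn⟩ => ⟨n, hn hx⟩⟩
  rw [h]
  exact h𝒮.sdiff_mem hA (h𝒮.iInter_mem _ fun n => h𝒮.sdiff_mem hA (hB n))

/-- A finitely additive set function on `𝒮` that is continuous at `∅`. -/
structure IsContinuousCharge {E : Type*} [AddCommMonoid E] [TopologicalSpace E]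
    (𝒮 : Set (Set S)) (T : Set S → E) : Prop where
  union : ∀ A ∈ 𝒮, ∀ B ∈ 𝒮, Disjoint A B → T (A ∪ B) = T A + T B
  tendsto_zero : ∀ s : ℕ → Set S, (∀ n, s n ∈ 𝒮) → Antitone s → ⋂ n, s n = ∅ →
    Tendsto (fun n => T (s n)) atTop (𝓝 0)

section

variable {E : Type*} [AddCommGroup E] [TopologicalSpace E] {T : Set S → E}

lemma IsContinuousCharge.empty (hT : IsContinuousCharge 𝒮 T) (h𝒮 : IsDeltaRing 𝒮) : T ∅ = 0 := by
  have := hT.union ∅ h𝒮.empty_mem ∅ h𝒮.empty_mem (by simp)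
  simpa using this

lemma IsContinuousCharge.biUnion (hT : IsContinuousCharge 𝒮 T) (h𝒮 : IsDeltaRing 𝒮)
    {A : ℕ → Set S} (hA : ∀ n, A n ∈ 𝒮) (hd : Pairwise (Function.onFun Disjoint A)) (n : ℕ) :
    T (⋃ i ∈ Finset.range n, A i) = ∑ i ∈ Finset.range n, T (A i) := by
  induction n with
  | zero => simp [hT.empty h𝒮]
  | succ n ih =>
    rw [Finset.sum_range_succ, ← ih, Finset.range_add_one, Finset.set_biUnion_insert, Set.union_comm]
    refine hT.union _ (h𝒮.toIsSetRing.biUnion_mem _ fun i _ => hA i) _ (hA n) ?_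
    simp only [Set.disjoint_iUnion_left]
    exact fun i hi => hd (Finset.mem_range.1 hi).ne

lemma IsContinuousCharge.tendsto_sum [IsTopologicalAddGroup E] (hT : IsContinuousCharge 𝒮 T) (h𝒮 : IsDeltaRing 𝒮)
    {A : ℕ → Set S} (hA : ∀ n, A n ∈ 𝒮) (hd : Pairwise (Function.onFun Disjoint A))
    (hU : ⋃ n, A n ∈ 𝒮) :
    Tendsto (fun n => ∑ i ∈ Finset.range n, T (A i)) atTop (𝓝 (T (⋃ n, A n))) := by
  let R : ℕ → Set S := fun n => (⋃ i, A i) \ ⋃ i ∈ Finset.range n, A i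
  have hB : ∀ n, ⋃ i ∈ Finset.range n, A i ∈ 𝒮 := fun n =>
    h𝒮.toIsSetRing.biUnion_mem _ fun i _ => hA i
  have hR : ∀ n, R n ∈ 𝒮 := fun n => h𝒮.sdiff_mem hU (hB n)
  have hsub : ∀ n, ⋃ i ∈ Finset.range n, A i ⊆ ⋃ i, A i := fun n =>
    Set.iUnion₂_subset fun i _ => Set.subset_iUnion A i
  have h1 : ∀ n, ∑ i ∈ Finset.range n, T (A i) = T (⋃ i, A i) - T (R n) := by
    intro n
    have h2 := hT.union _ (hB n) _ (hR n) Set.disjoint_sdiff_right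
    rw [Set.union_sdiff_cancel (hsub n), hT.biUnion h𝒮 hA hd] at h2
    rw [h2, add_sub_cancel_right]
  have h3 := hT.tendsto_zero R hR (fun a b hab => Set.sdiff_subset_sdiff_right
    (Set.biUnion_subset_biUnion_left fun i hi => by
      simp only [Finset.coe_range, Set.mem_Iio] at hi ⊢
      exact lt_of_lt_of_le hi hab)) (by
    refine Set.eq_empty_of_forall_notMem fun x hx => ?_
    simp only [R, Set.mem_iInter, Set.mem_sdiff, Set.mem_iUnion, Finset.mem_range] at hx
    obtain ⟨i, hi⟩ := (hx 0).1
    exact (hx (i + 1)).2 ⟨i, by omega, hi⟩)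
  simp only [h1]
  simpa using h3.const_sub (T (⋃ i, A i))

end

/-- Choosing for `B` the indices of the non-negative terms and their complement gives two convergent
series of constant sign. -/
lemma summable_of_tendsto_subset_sums {a : ℕ → ℝ}
    (h : ∀ B : Set ℕ, ∃ l, Tendsto (fun n => ∑ i ∈ Finset.range n, B.indicator a i) atTop (𝓝 l)) :
    Summable a := by
  obtain ⟨l₁, h₁⟩ := h {i | 0 ≤ a i}
  obtain ⟨l₂, h₂⟩ := h {i | 0 ≤ a i}ᶜ
  have s₁ : Summable ({i | 0 ≤ a i}.indicator a) :=
    ((hasSum_iff_tendsto_nat_of_nonneg (fun i => Set.indicator_nonneg (fun i hi => hi) i) l₁).2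
      h₁).summable
  have s₂ : Summable (fun i => -({i | 0 ≤ a i}ᶜ.indicator a i)) := by
    refine ((hasSum_iff_tendsto_nat_of_nonneg (fun i => ?_) (-l₂)).2 ?_).summable
    · rw [neg_nonneg]
      exact Set.indicator_nonpos (fun i hi => (not_le.1 hi).le) i
    · simpa using h₂.neg
  have := s₁.sub s₂
  refine this.congr fun i => ?_
  rw [sub_neg_eq_add]
  exact (congrFun (Set.indicator_self_add_compl {i | 0 ≤ a i} a) i)

variable {T : Set S → RVec m}

/-- Every subfamily also has its union in `𝒮`, so every subseries converges, and in each coordinate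
this makes the convergence unconditional, as a vector measure requires. -/
lemma IsContinuousCharge.hasSum (hT : IsContinuousCharge 𝒮 T) (h𝒮 : IsDeltaRing 𝒮)
    {A : ℕ → Set S} (hA : ∀ n, A n ∈ 𝒮) (hd : Pairwise (Function.onFun Disjoint A))
    (hU : ⋃ n, A n ∈ 𝒮) : HasSum (fun n => T (A n)) (T (⋃ n, A n)) := by
  classical
  have hsum : Summable fun n => WithLp.ofLp (T (A n)) := by
    refine Pi.summable.2 fun j => summable_of_tendsto_subset_sums fun B => ?_
    let A' : ℕ → Set S := fun n => if n ∈ B then A n else ∅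
    have hA'A : ∀ n, A' n ⊆ A n := fun n => by
      simp only [A']; split_ifs <;> simp
    have hA' : ∀ n, A' n ∈ 𝒮 := fun n => by
      simp only [A']; split_ifs
      exacts [hA n, h𝒮.empty_mem]
    have h1 := hT.tendsto_sum h𝒮 hA' (fun i k hik => (hd hik).mono (hA'A i) (hA'A k))
      (h𝒮.iUnion_mem_of_subset hU hA' fun n => (hA'A n).trans (Set.subset_iUnion A n))
    have hc : Continuous fun x : RVec m => x j := by fun_prop
    refine ⟨_, ((hc.tendsto _).comp h1).congr fun n => ?_⟩
    simp only [Function.comp_apply, WithLp.ofLp_sum, Finset.sum_apply]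
    refine Finset.sum_congr rfl fun i _ => ?_
    by_cases hi : i ∈ B
    · simp [A', hi]
    · simp [A', hi, hT.empty h𝒮]
  have hsum' : Summable fun n => T (A n) := by
    have := hsum.map (EuclideanSpace.equiv (Fin m) ℝ).symm
      (EuclideanSpace.equiv (Fin m) ℝ).symm.continuous
    exact this
  have h2 := hsum'.hasSum
  rwa [tendsto_nhds_unique h2.tendsto_sum_nat (hT.tendsto_sum h𝒮 hA hd hU)] at h2

/-- The `σ`-algebra of the sets whose trace on `A` lies in the `δ`-ring. -/
abbrev traceSpace (h𝒮 : IsDeltaRing 𝒮) {A : Set S} (hA : A ∈ 𝒮) : MeasurableSpace S where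
  MeasurableSet' B := A ∩ B ∈ 𝒮
  measurableSet_empty := by simpa using h𝒮.empty_mem
  measurableSet_compl B hB := by
    have : A ∩ Bᶜ = A \ (A ∩ B) := by ext x; simp
    rw [this]
    exact h𝒮.sdiff_mem hA hB
  measurableSet_iUnion B hB := by
    rw [Set.inter_iUnion]
    exact h𝒮.iUnion_mem_of_subset hA hB fun n => Set.inter_subset_left

lemma measurableSet_traceSpace (h𝒮 : IsDeltaRing 𝒮) {A : Set S} (hA : A ∈ 𝒮) {B : Set S} :
    MeasurableSet[traceSpace h𝒮 hA] B ↔ A ∩ B ∈ 𝒮 := Iff.rfl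

open Classical in
/-- The vector measure `B ↦ T (A ∩ B)`. -/
def IsContinuousCharge.vectorMeasure (hT : IsContinuousCharge 𝒮 T) (h𝒮 : IsDeltaRing 𝒮)
    {A : Set S} (hA : A ∈ 𝒮) : @VectorMeasure S (traceSpace h𝒮 hA) (RVec m) _ _ :=
  letI := traceSpace h𝒮 hA
  { measureOf' := fun B => if A ∩ B ∈ 𝒮 then T (A ∩ B) else 0
    empty' := by simp [hT.empty h𝒮]
    not_measurable' := fun B hB => if_neg hB
    m_iUnion' := fun B hB hd => by
      have hB' : ∀ n, A ∩ B n ∈ 𝒮 := hB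
      have hU : ⋃ n, A ∩ B n ∈ 𝒮 := h𝒮.iUnion_mem_of_subset hA hB' fun n => Set.inter_subset_left
      simp only [Set.inter_iUnion, hB', hU, if_true]
      exact hT.hasSum h𝒮 hB' (fun i k hik => (hd hik).mono Set.inter_subset_right
        Set.inter_subset_right) hU }

open Classical in
lemma IsContinuousCharge.vectorMeasure_apply (hT : IsContinuousCharge 𝒮 T) (h𝒮 : IsDeltaRing 𝒮)
    {A : Set S} (hA : A ∈ 𝒮) {B : Set S} (hB : B ∈ 𝒮) (hBA : B ⊆ A) :
    hT.vectorMeasure h𝒮 hA B = T B := by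
  have : A ∩ B = B := Set.inter_eq_right.2 hBA
  change (if A ∩ B ∈ 𝒮 then T (A ∩ B) else 0) = T B
  rw [this, if_pos hB]

lemma measurableSet_traceSpace_of_subset (h𝒮 : IsDeltaRing 𝒮) {A : Set S} (hA : A ∈ 𝒮) {B : Set S}
    (hBA : B ⊆ A) : MeasurableSet[traceSpace h𝒮 hA] B ↔ B ∈ 𝒮 := by
  rw [measurableSet_traceSpace, Set.inter_eq_right.2 hBA]

/-- Inside `A`, measurability for `traceSpace` is membership in `𝒮`. The ambient `A` is kept apart
from `B` so that the variations of several subsets become values of one measure. -/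
lemma IsContinuousCharge.totalVariation_eq (hT : IsContinuousCharge 𝒮 T) (h𝒮 : IsDeltaRing 𝒮)
    {A : Set S} (hA : A ∈ 𝒮) {B : Set S} (hB : B ∈ 𝒮) (hBA : B ⊆ A) :
    totalVariation 𝒮 T B = (hT.vectorMeasure h𝒮 hA).variation B := by
  let _ := traceSpace h𝒮 hA
  have hmeas : ∀ {C : Set S}, C ⊆ B → (MeasurableSet C ↔ C ∈ 𝒮) := fun hC =>
    measurableSet_traceSpace_of_subset h𝒮 hA (hC.trans hBA)
  refine le_antisymm ?_ (le_of_forall_lt fun a ha => ?_)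
  · refine iSup_le fun n => iSup_le fun C => iSup_le fun hC => iSup_le fun hd => ?_
    calc ∑ j, ‖T (C j)‖ₑ ≤ ∑ j, (hT.vectorMeasure h𝒮 hA).variation (C j) := by
          refine Finset.sum_le_sum fun j _ => ?_
          rw [← hT.vectorMeasure_apply h𝒮 hA (hC j).1 ((hC j).2.trans hBA)]
          exact VectorMeasure.enorm_measure_le_variation _ _
      _ = (hT.vectorMeasure h𝒮 hA).variation (⋃ j, C j) := by
          rw [measure_iUnion hd fun j => (hmeas (hC j).2).2 (hC j).1, tsum_fintype]
      _ ≤ _ := measure_mono (Set.iUnion_subset fun j => (hC j).2)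
  · obtain ⟨P, hPB, hPd, hPm, hlt⟩ := VectorMeasure.exists_lt_sum_of_lt_variation
      (hT.vectorMeasure h𝒮 hA) ((hmeas subset_rfl).2 hB) ha
    refine hlt.trans_le ?_
    let e := P.equivFin.symm
    have hmem : ∀ j, ((e j : Set S) ∈ 𝒮 ∧ (e j : Set S) ⊆ B) := fun j =>
      ⟨(hmeas (hPB _ (e j).2)).1 (hPm _ (e j).2), hPB _ (e j).2⟩
    have hsum : ∑ p ∈ P, ‖hT.vectorMeasure h𝒮 hA p‖ₑ = ∑ j, ‖T (e j)‖ₑ := by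
      rw [← Finset.sum_coe_sort P, ← e.sum_comp]
      refine Finset.sum_congr rfl fun j _ => ?_
      rw [hT.vectorMeasure_apply h𝒮 hA (hmem j).1 ((hmem j).2.trans hBA)]
    rw [hsum]
    refine le_iSup_of_le P.card (le_iSup_of_le (fun j => (e j : Set S)) (le_iSup_of_le hmem
      (le_iSup_of_le (fun i j hij => ?_) le_rfl)))
    exact hPd (e i).2 (e j).2 fun h => hij (e.injective (Subtype.ext h))

/-- The total variation of a charge is realized by the values on one subset per coordinate, up to
a factor. -/
lemma IsContinuousCharge.exists_totalVariation_le (hT : IsContinuousCharge 𝒮 T)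
    (h𝒮 : IsDeltaRing 𝒮) {A : Set S} (hA : A ∈ 𝒮) :
    ∃ B : Fin m → Set S, (∀ i, B i ∈ 𝒮 ∧ B i ⊆ A) ∧
      totalVariation 𝒮 T A ≤ ∑ i, 4 * ‖T (B i)‖ₑ := by
  let _ := traceSpace h𝒮 hA
  let v := hT.vectorMeasure h𝒮 hA
  let L : Fin m → RVec m →L[ℝ] ℝ := fun i => EuclideanSpace.proj i
  let w : Fin m → SignedMeasure S := fun i => v.mapRange (L i : RVec m →+ ℝ) (L i).continuous
  have hw : ∀ i C, w i C = v C i := fun i C => rfl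
  have hv : v.variation A ≤ ∑ i, (w i).variation A := by
    have h1 : v.variation ≤ ∑ i, (w i).variation := by
      refine VectorMeasure.variation_le_of_forall_enorm_le fun C _ => ?_
      rw [Measure.finsetSum_apply]
      refine le_trans ?_ (Finset.sum_le_sum fun i _ =>
        VectorMeasure.enorm_measure_le_variation (w i) C)
      have h2 : v C = ∑ i, EuclideanSpace.single i (v C i) := by
        ext j
        simp [Pi.single_apply]
      calc ‖v C‖ₑ = ‖∑ i, EuclideanSpace.single i (v C i)‖ₑ := by rw [← h2]
        _ ≤ ∑ i, ‖EuclideanSpace.single i (v C i)‖ₑ := enorm_sum_le _ _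
        _ = ∑ i, ‖w i C‖ₑ := Finset.sum_congr rfl fun i _ => by
            rw [hw, ← ofReal_norm, PiLp.norm_single, ofReal_norm]
    refine (h1 A).trans_eq ?_
    rw [Measure.finsetSum_apply]
  have hfin : ∀ i, (w i).variation A ≠ ∞ := fun i => by
    rw [← SignedMeasure.totalVariation_eq_variation]
    exact measure_ne_top _ _
  have hAm : MeasurableSet A := (measurableSet_traceSpace_of_subset h𝒮 hA subset_rfl).2 hA
  have hex : ∀ i, ∃ B : Set S, (B ∈ 𝒮 ∧ B ⊆ A) ∧ (w i).variation A ≤ 4 * ‖T B‖ₑ := by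
    intro i
    rcases eq_or_ne ((w i).variation A) 0 with h0 | h0
    · exact ⟨∅, ⟨h𝒮.empty_mem, Set.empty_subset _⟩, by simp [h0]⟩
    -- The lemma needs a number strictly below the variation and costs a factor `2`; taking half the
    -- finite, non-zero variation costs another, whence `4`.
    · obtain ⟨B, hBA, hBm, hB⟩ := SignedMeasure.exists_subset_lt_enorm_apply_of_lt_variation (w i)
        hAm (ENNReal.half_lt_self h0 (hfin i))
      have hB𝒮 := (measurableSet_traceSpace_of_subset h𝒮 hA hBA).1 hBm
      refine ⟨B, ⟨hB𝒮, hBA⟩, ?_⟩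
      have h3 : ‖w i B‖ₑ ≤ ‖T B‖ₑ := by
        rw [hw, hT.vectorMeasure_apply h𝒮 hA hB𝒮 hBA, ← ofReal_norm, ← ofReal_norm]
        exact ENNReal.ofReal_le_ofReal (PiLp.norm_apply_le _ _)
      calc (w i).variation A = 2 * ((w i).variation A / 2) := by
            rw [ENNReal.mul_div_cancel two_ne_zero ENNReal.ofNat_ne_top]
        _ ≤ 2 * (2 * ‖T B‖ₑ) := by
            gcongr
            exact hB.le.trans (by gcongr)
        _ = 4 * ‖T B‖ₑ := by rw [← mul_assoc]; norm_num
  choose B hB hBle using hex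
  refine ⟨B, hB, ?_⟩
  rw [hT.totalVariation_eq h𝒮 hA hA subset_rfl]
  exact hv.trans (Finset.sum_le_sum fun i _ => hBle i)

lemma IsContinuousCharge.totalVariation_lt_top (hT : IsContinuousCharge 𝒮 T)
    (h𝒮 : IsDeltaRing 𝒮) {A : Set S} (hA : A ∈ 𝒮) : totalVariation 𝒮 T A < ∞ := by
  obtain ⟨B, -, hB⟩ := hT.exists_totalVariation_le h𝒮 hA
  exact hB.trans_lt (ENNReal.sum_lt_top.2 fun i _ => ENNReal.mul_lt_top (by simp) enorm_lt_top)

lemma enorm_le_totalVariation (T : Set S → RVec m) {A : Set S} (hA : A ∈ 𝒮) :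
    ‖T A‖ₑ ≤ totalVariation 𝒮 T A := by
  refine le_iSup_of_le 1 (le_iSup_of_le (fun _ => A) (le_iSup_of_le (fun _ => ⟨hA, subset_rfl⟩)
    (le_iSup_of_le (fun i j hij => absurd (Subsingleton.elim i j) hij) ?_)))
  simp

lemma IsContinuousCharge.isContinuousCharge_totalVariation (hT : IsContinuousCharge 𝒮 T) (h𝒮 : IsDeltaRing 𝒮) :
    IsContinuousCharge 𝒮 (totalVariation 𝒮 T) where
  union A hA B hB hd := by
    have hU := h𝒮.union_mem hA hB
    let _ := traceSpace h𝒮 hU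
    rw [hT.totalVariation_eq h𝒮 hU hU subset_rfl,
      hT.totalVariation_eq h𝒮 hU hA Set.subset_union_left,
      hT.totalVariation_eq h𝒮 hU hB Set.subset_union_right]
    exact measure_union hd ((measurableSet_traceSpace_of_subset h𝒮 hU Set.subset_union_right).2 hB)
  tendsto_zero s hs hanti hempty := by
    let _ := traceSpace h𝒮 (hs 0)
    have hsub : ∀ n, s n ⊆ s 0 := fun n => hanti (Nat.zero_le n)
    have h1 : ∀ n, totalVariation 𝒮 T (s n) = (hT.vectorMeasure h𝒮 (hs 0)).variation (s n) :=
      fun n => hT.totalVariation_eq h𝒮 (hs 0) (hs n) (hsub n)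
    have h2 := tendsto_measure_iInter_atTop (μ := (hT.vectorMeasure h𝒮 (hs 0)).variation)
      (fun n => ((measurableSet_traceSpace_of_subset h𝒮 (hs 0) (hsub n)).2
        (hs n)).nullMeasurableSet) hanti
      ⟨0, by rw [← h1]; exact (hT.totalVariation_lt_top h𝒮 (hs 0)).ne⟩
    rw [hempty, measure_empty] at h2
    exact h2.congr fun n => (h1 n).symm

/-- A finite continuous charge on a `δ`-ring with values in `[0, ∞)` extends to a `σ`-finite
measure. -/
lemma IsContinuousCharge.exists_measure {T : Set S → ℝ≥0∞} (hT : IsContinuousCharge 𝒮 T)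
    (h𝒮 : IsDeltaRing 𝒮) (hfin : ∀ A ∈ 𝒮, T A < ∞) :
    ∃ lam : @Measure S (MeasurableSpace.generateFrom 𝒮), SigmaFinite lam ∧
      (∀ A ∈ 𝒮, lam A = T A) ∧ ∀ lam' : @Measure S (MeasurableSpace.generateFrom 𝒮),
        (∀ A ∈ 𝒮, lam' A = T A) → lam' = lam := by
  let _ := MeasurableSpace.generateFrom 𝒮
  have hring := h𝒮.toIsSetRing
  have hempty : T ∅ = 0 := by
    have h1 := hT.union ∅ h𝒮.empty_mem ∅ h𝒮.empty_mem (by simp)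
    rw [Set.union_empty] at h1
    have h2 : T ∅ + 0 = T ∅ + T ∅ := by rw [add_zero]; exact h1
    exact ((ENNReal.add_right_inj (hfin ∅ h𝒮.empty_mem).ne).1 h2).symm
  let c : AddContent ℝ≥0∞ 𝒮 := hring.addContent_of_union T hempty
    fun hs ht hd => hT.union _ hs _ ht hd
  have hc : ∀ A, c A = T A := fun A => rfl
  -- With finite values, continuity at `∅` upgrades finite to countable additivity, as
  -- Carathéodory's extension needs.
  have hσ : c.IsSigmaSubadditive := isSigmaSubadditive_of_addContent_iUnion_eq_tsum hring
    fun f hf hU hd => addContent_iUnion_eq_sum_of_tendsto_zero hring c (fun A hA => (hfin A hA).ne)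
      (fun s hs ha he => hT.tendsto_zero s hs ha he) hf hU hd
  let lam : Measure S := c.measure hring.isSetSemiring le_rfl hσ
  have hlam : ∀ A ∈ 𝒮, lam A = T A := fun A hA => c.measure_eq hring.isSetSemiring rfl hσ hA
  obtain ⟨B, hB, hBU⟩ := h𝒮.exists_cover
  refine ⟨lam, ⟨⟨⟨B, fun _ => trivial, fun n => ?_, hBU⟩⟩⟩, hlam, fun lam' h' => ?_⟩
  · rw [hlam _ (hB n)]
    exact hfin _ (hB n)
  · refine Measure.ext_of_generateFrom_of_iUnion 𝒮 B rfl
      (fun s hs t ht _ => hring.inter_mem hs ht) hBU hB (fun n => ?_) fun A hA => ?_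
    · rw [h' _ (hB n)]
      exact (hfin _ (hB n)).ne
    · rw [h' A hA, hlam A hA]

end Charges

/-! ### The triplets of a random measure as charges, and the two convergence statements. -/

section RandomMeasure

variable {S Ω : Type*} [MeasurableSpace Ω] {P : Measure Ω} {m : ℕ} {𝒮 : Set (Set S)}
  {M : Set S → Ω → RVec m}

/-- The constant sequence `∅` is disjoint, and a convergent series with equal terms has zero terms.
This allows finite families to be padded with `∅`. -/
lemma IsISRM.ae_empty (hM : IsISRM P 𝒮 M) (h𝒮 : IsDeltaRing 𝒮) : ∀ᵐ ω ∂P, M ∅ ω = 0 := by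
  have h := hM.sigma_additive (fun _ => ∅) (fun _ => h𝒮.empty_mem) (fun _ _ _ => by simp)
    (by simpa using h𝒮.empty_mem)
  filter_upwards [h] with ω hω
  simp only [Finset.sum_const, Finset.card_range, Set.iUnion_empty] at hω
  have h1 := ((tendsto_add_atTop_iff_nat 1).2 hω).sub hω
  rw [sub_self] at h1
  refine tendsto_nhds_unique (tendsto_const_nhds.congr fun n => ?_) h1
  rw [succ_nsmul, add_sub_cancel_left]

lemma IsISRM.ae_union (hM : IsISRM P 𝒮 M) (h𝒮 : IsDeltaRing 𝒮) {A B : Set S} (hA : A ∈ 𝒮)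
    (hB : B ∈ 𝒮) (hd : Disjoint A B) : ∀ᵐ ω ∂P, M (A ∪ B) ω = M A ω + M B ω := by
  let F : ℕ → Set S := fun n => if n = 0 then A else if n = 1 then B else ∅
  have hF : ∀ n, F n ∈ 𝒮 := fun n => by
    simp only [F]; split_ifs
    exacts [hA, hB, h𝒮.empty_mem]
  have hU : ⋃ n, F n = A ∪ B := by
    refine Set.Subset.antisymm (Set.iUnion_subset fun n => ?_) (Set.union_subset ?_ ?_)
    · simp only [F]; split_ifs
      exacts [Set.subset_union_left, Set.subset_union_right, Set.empty_subset _]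
    · exact Set.subset_iUnion F 0
    · exact Set.subset_iUnion F 1
  have hdF : Pairwise (Function.onFun Disjoint F) := by
    intro i j hij
    simp only [Function.onFun, F]
    split_ifs <;> first | omega | exact hd | exact hd.symm | simp
  have h := hM.sigma_additive F hF hdF (hU ▸ h𝒮.union_mem hA hB)
  filter_upwards [h, hM.ae_empty h𝒮] with ω hω h0
  rw [hU] at hω
  refine tendsto_nhds_unique ((tendsto_add_atTop_iff_nat 2).2 hω) (tendsto_const_nhds.congr ?_)
  intro n
  induction n with
  | zero => simp [Finset.sum_range_succ, F]
  | succ n ih => rw [add_right_comm, Finset.sum_range_succ, ← ih]; simp [F, h0]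

lemma IsISRM.charFun_union (hM : IsISRM P 𝒮 M) (h𝒮 : IsDeltaRing 𝒮) [IsProbabilityMeasure P]
    {A B : Set S} (hA : A ∈ 𝒮) (hB : B ∈ 𝒮) (hd : Disjoint A B) (t : RVec m) :
    charFun (P.map (M (A ∪ B))) t = charFun (P.map (M A)) t * charFun (P.map (M B)) t := by
  have hind := hM.indep 2 ![A, B] (fun i => by fin_cases i <;> simpa) (fun i j hij => by
    fin_cases i <;> fin_cases j <;> simp_all [Function.onFun, hd.symm])
  have h01 : IndepFun (M A) (M B) P := hind.indepFun (i := 0) (j := 1) (by simp)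
  rw [Measure.map_congr (hM.ae_union h𝒮 hA hB hd)]
  have := h01.charFun_map_fun_add_eq_mul (hM.measurable A hA).aemeasurable
    (hM.measurable B hB).aemeasurable
  rw [this, Pi.mul_apply]

/-- The layers `s n \ s (n + 1)` partition `s 0`, so `M (s n)` is the tail of an almost surely
convergent series. -/
lemma IsISRM.ae_tendsto_zero (hM : IsISRM P 𝒮 M) (h𝒮 : IsDeltaRing 𝒮) {s : ℕ → Set S}
    (hs : ∀ n, s n ∈ 𝒮) (hanti : Antitone s) (hempty : ⋂ n, s n = ∅) :
    ∀ᵐ ω ∂P, Tendsto (fun n => M (s n) ω) atTop (𝓝 0) := by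
  let d : ℕ → Set S := fun n => s n \ s (n + 1)
  have hd𝒮 : ∀ n, d n ∈ 𝒮 := fun n => h𝒮.sdiff_mem (hs n) (hs (n + 1))
  have hsub : ∀ n, s (n + 1) ⊆ s n := fun n => hanti (Nat.le_succ n)
  have hU : ⋃ n, d n = s 0 := by
    refine Set.Subset.antisymm (Set.iUnion_subset fun n => Set.sdiff_subset.trans
      (hanti (Nat.zero_le n))) fun x hx => ?_
    by_contra hcon
    simp only [Set.mem_iUnion, not_exists, d, Set.mem_sdiff, not_and, not_not] at hcon
    have hall : ∀ n, x ∈ s n := fun n => by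
      induction n with
      | zero => exact hx
      | succ n ih => exact hcon n ih
    have : x ∈ ⋂ n, s n := Set.mem_iInter.2 hall
    rw [hempty] at this
    exact this
  have hdisj : Pairwise (Function.onFun Disjoint d) := by
    refine (pairwise_disjoint_on d).2 fun i j hij => ?_
    refine Set.disjoint_left.2 fun x hxi hxj => hxi.2 ?_
    exact hanti (Nat.succ_le_of_lt hij) hxj.1
  have h1 := hM.sigma_additive d hd𝒮 hdisj (hU ▸ hs 0)
  have h2 : ∀ᵐ ω ∂P, ∀ n, M (s n) ω = M (s (n + 1)) ω + M (d n) ω := ae_all_iff.2 fun n => by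
    have := hM.ae_union h𝒮 (hs (n + 1)) (hd𝒮 n) Set.disjoint_sdiff_right
    rwa [Set.union_sdiff_cancel (hsub n)] at this
  filter_upwards [h1, h2] with ω hω1 hω2
  rw [hU] at hω1
  have h3 : ∀ n, M (s n) ω = M (s 0) ω - ∑ i ∈ Finset.range n, M (d i) ω := by
    intro n
    induction n with
    | zero => simp
    | succ n ih =>
      rw [Finset.sum_range_succ, ← sub_sub, ← ih, hω2 n, add_sub_cancel_right]
  have h4 := hω1.const_sub (M (s 0) ω)
  rw [sub_self] at h4
  exact h4.congr fun n => (h3 n).symm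

variable [IsProbabilityMeasure P]

lemma IsISRM.tendstoInMeasure_zero (hM : IsISRM P 𝒮 M) (h𝒮 : IsDeltaRing 𝒮) {s : ℕ → Set S}
    (hs : ∀ n, s n ∈ 𝒮) (hanti : Antitone s) (hempty : ⋂ n, s n = ∅) :
    TendstoInMeasure P (fun n => M (s n)) atTop fun _ => 0 :=
  tendstoInMeasure_of_tendsto_ae (fun n => (hM.measurable _ (hs n)).aestronglyMeasurable)
    (hM.ae_tendsto_zero h𝒮 hs hanti hempty)

variable {γ : Set S → RVec m} {Q : Set S → Matrix (Fin m) (Fin m) ℝ}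
  {φ : Set S → Measure (RVec m)}

lemma IsISRM.tendsto_spread_zero (hM : IsISRM P 𝒮 M)
    (h : ∀ A ∈ 𝒮, HasLevyTriplet (P.map (M A)) (γ A) (Q A) (φ A)) {s : ℕ → Set S}
    (hs : ∀ n, s n ∈ 𝒮) (hlim : TendstoInMeasure P (fun n => M (s n)) atTop fun _ => 0) :
    Tendsto (fun n => spread (Q (s n)) (φ (s n))) atTop (𝓝 0) := by
  rw [ENNReal.tendsto_nhds_zero]
  intro ε hε
  obtain ⟨δ, hδ, hδε⟩ : ∃ δ : ℝ, 0 < δ ∧ ENNReal.ofReal δ ≤ ε := by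
    rcases eq_or_ne ε ∞ with rfl | hε'
    · exact ⟨1, one_pos, le_top⟩
    · exact ⟨ε.toReal, ENNReal.toReal_pos hε.ne' hε', by rw [ENNReal.ofReal_toReal hε']⟩
  -- `1/2` and `44 m` come from `HasLevyTriplet.spread_le`; `m + 1` covers `m = 0`.
  have hη : 0 < min (1 / 2) (δ / (44 * (m + 1))) := by positivity
  filter_upwards [hlim.eventually_norm_charFun_sub_one_le (fun n => hM.measurable _ (hs n)) 1 hη]
    with n hn
  refine ((h _ (hs n)).spread_le (min_le_left _ _) hn).trans
    ((ENNReal.ofReal_le_ofReal ?_).trans hδε)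
  calc 44 * (m : ℝ) * min (1 / 2) (δ / (44 * (m + 1)))
      ≤ 44 * m * (δ / (44 * (m + 1))) := by gcongr; exact min_le_right _ _
    _ ≤ δ := by
        rw [mul_div_assoc', div_le_iff₀ (by positivity)]
        nlinarith

lemma IsISRM.tendsto_drift_zero (hM : IsISRM P 𝒮 M)
    (h : ∀ A ∈ 𝒮, HasLevyTriplet (P.map (M A)) (γ A) (Q A) (φ A)) {s : ℕ → Set S}
    (hs : ∀ n, s n ∈ 𝒮) (hlim : TendstoInMeasure P (fun n => M (s n)) atTop fun _ => 0) :
    Tendsto (fun n => γ (s n)) atTop (𝓝 0) :=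
  tendsto_drift_zero_of_triplet (fun n => h _ (hs n)) (hM.tendsto_spread_zero h hs hlim)
    (hlim.tendsto_charFun fun n => hM.measurable _ (hs n))

/-- Independence multiplies the characteristic functions; the sum of the triplets is then a triplet
of `M (A ∪ B)`, hence the only one. -/
lemma IsISRM.triplet_union (hM : IsISRM P 𝒮 M) (h𝒮 : IsDeltaRing 𝒮)
    (h : ∀ A ∈ 𝒮, HasLevyTriplet (P.map (M A)) (γ A) (Q A) (φ A)) {A B : Set S} (hA : A ∈ 𝒮)
    (hB : B ∈ 𝒮) (hd : Disjoint A B) :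
    γ (A ∪ B) = γ A + γ B ∧ Q (A ∪ B) = Q A + Q B ∧ φ (A ∪ B) = φ A + φ B :=
  (h _ (h𝒮.union_mem hA hB)).unique ((h A hA).add (h B hB) (hM.charFun_union h𝒮 hA hB hd))

lemma IsISRM.isContinuousCharge_drift (hM : IsISRM P 𝒮 M) (h𝒮 : IsDeltaRing 𝒮)
    (h : ∀ A ∈ 𝒮, HasLevyTriplet (P.map (M A)) (γ A) (Q A) (φ A)) : IsContinuousCharge 𝒮 γ where
  union _ hA _ hB hd := (hM.triplet_union h𝒮 h hA hB hd).1
  tendsto_zero _ hs ha he := hM.tendsto_drift_zero h hs (hM.tendstoInMeasure_zero h𝒮 hs ha he)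

lemma IsISRM.isContinuousCharge_spread (hM : IsISRM P 𝒮 M) (h𝒮 : IsDeltaRing 𝒮)
    (h : ∀ A ∈ 𝒮, HasLevyTriplet (P.map (M A)) (γ A) (Q A) (φ A)) :
    IsContinuousCharge 𝒮 fun A => spread (Q A) (φ A) where
  union A hA B hB hd := by
    obtain ⟨-, hQ, hφ⟩ := hM.triplet_union h𝒮 h hA hB hd
    simp only [spread, hQ, hφ, Matrix.trace_add, minSqIntegral_add]
    rw [ENNReal.ofReal_add (h A hA).posSemidef.trace_nonneg (h B hB).posSemidef.trace_nonneg]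
    exact add_add_add_comm _ _ _ _
  tendsto_zero _ hs ha he := hM.tendsto_spread_zero h hs (hM.tendstoInMeasure_zero h𝒮 hs ha he)

lemma controlValue_eq (𝒮 : Set (Set S)) (γ : Set S → RVec m)
    (Q : Set S → Matrix (Fin m) (Fin m) ℝ) (φ : Set S → Measure (RVec m)) (A : Set S) :
    controlValue 𝒮 γ Q φ A = totalVariation 𝒮 γ A + spread (Q A) (φ A) := add_assoc _ _ _

lemma IsISRM.isContinuousCharge_controlValue (hM : IsISRM P 𝒮 M) (h𝒮 : IsDeltaRing 𝒮)
    (h : ∀ A ∈ 𝒮, HasLevyTriplet (P.map (M A)) (γ A) (Q A) (φ A)) :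
    IsContinuousCharge 𝒮 (controlValue 𝒮 γ Q φ) := by
  have h1 := (hM.isContinuousCharge_drift h𝒮 h).isContinuousCharge_totalVariation h𝒮
  have h2 := hM.isContinuousCharge_spread h𝒮 h
  refine ⟨fun A hA B hB hd => ?_, fun s hs ha he => ?_⟩
  · simp only [controlValue_eq, h1.union A hA B hB hd, h2.union A hA B hB hd]
    exact add_add_add_comm _ _ _ _
  · simp only [controlValue_eq]
    simpa using (h1.tendsto_zero s hs ha he).add (h2.tendsto_zero s hs ha he)

lemma IsISRM.controlValue_lt_top (hM : IsISRM P 𝒮 M) (h𝒮 : IsDeltaRing 𝒮)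
    (h : ∀ A ∈ 𝒮, HasLevyTriplet (P.map (M A)) (γ A) (Q A) (φ A)) {A : Set S} (hA : A ∈ 𝒮) :
    controlValue 𝒮 γ Q φ A < ∞ := by
  rw [controlValue_eq]
  exact ENNReal.add_lt_top.2 ⟨(hM.isContinuousCharge_drift h𝒮 h).totalVariation_lt_top h𝒮 hA,
    ENNReal.add_lt_top.2 ⟨ENNReal.ofReal_lt_top, (h A hA).isLevyMeasure.minSqIntegral_lt_top⟩⟩

lemma IsISRM.tendstoInMeasure_of_tendsto_controlValue (hM : IsISRM P 𝒮 M)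
    (h : ∀ A ∈ 𝒮, HasLevyTriplet (P.map (M A)) (γ A) (Q A) (φ A)) {A : ℕ → Set S}
    (hA : ∀ n, A n ∈ 𝒮) (hlim : Tendsto (fun n => controlValue 𝒮 γ Q φ (A n)) atTop (𝓝 0)) :
    TendstoInMeasure P (fun n => M (A n)) atTop fun _ => 0 := by
  simp only [controlValue_eq] at hlim
  have hs : Tendsto (fun n => spread (Q (A n)) (φ (A n))) atTop (𝓝 0) :=
    tendsto_of_tendsto_of_tendsto_of_le_of_le tendsto_const_nhds hlim (fun _ => zero_le)
      fun _ => le_add_self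
  have hγ : Tendsto (fun n => γ (A n)) atTop (𝓝 0) := by
    rw [tendsto_zero_iff_norm_tendsto_zero]
    have h1 : Tendsto (fun n => ‖γ (A n)‖ₑ) atTop (𝓝 0) :=
      tendsto_of_tendsto_of_tendsto_of_le_of_le tendsto_const_nhds hlim (fun _ => zero_le)
        fun n => (enorm_le_totalVariation γ (hA n)).trans le_self_add
    have h2 := (ENNReal.tendsto_toReal ENNReal.zero_ne_top).comp h1
    simpa [Function.comp_def] using h2
  exact tendstoInMeasure_of_tendsto_charFun (fun n => hM.measurable _ (hA n))
    (tendsto_charFun_one_of_triplet (fun n => h _ (hA n)) hs hγ)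

/-- The sets `A n` themselves suffice for the Gaussian and jump parts. For the variation of the
drift the hypothesis is applied, for each coordinate, to the subsets that nearly realize it. -/
lemma IsISRM.tendsto_controlValue (hM : IsISRM P 𝒮 M) (h𝒮 : IsDeltaRing 𝒮)
    (h : ∀ A ∈ 𝒮, HasLevyTriplet (P.map (M A)) (γ A) (Q A) (φ A)) {A : ℕ → Set S}
    (hA : ∀ n, A n ∈ 𝒮) (hlim : ∀ A' : ℕ → Set S, (∀ n, A' n ∈ 𝒮) → (∀ n, A' n ⊆ A n) →
      TendstoInMeasure P (fun n => M (A' n)) atTop fun _ => 0) :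
    Tendsto (fun n => controlValue 𝒮 γ Q φ (A n)) atTop (𝓝 0) := by
  have hs := hM.tendsto_spread_zero h hA (hlim A hA fun _ => subset_rfl)
  choose B hB hBle using fun n =>
    (hM.isContinuousCharge_drift h𝒮 h).exists_totalVariation_le h𝒮 (hA n)
  have h1 : Tendsto (fun n => ∑ i, 4 * ‖γ (B n i)‖ₑ) atTop (𝓝 0) := by
    have h2 : ∀ i, Tendsto (fun n => 4 * ‖γ (B n i)‖ₑ) atTop (𝓝 0) := fun i => by
      have h3 := hM.tendsto_drift_zero h (fun n => (hB n i).1)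
        (hlim (fun n => B n i) (fun n => (hB n i).1) fun n => (hB n i).2)
      have h4 := ENNReal.Tendsto.const_mul (a := 4) h3.enorm (Or.inr (by simp))
      simpa using h4
    simpa using tendsto_finsetSum Finset.univ fun i _ => h2 i
  have h5 : Tendsto (fun n => totalVariation 𝒮 γ (A n)) atTop (𝓝 0) :=
    tendsto_of_tendsto_of_tendsto_of_le_of_le tendsto_const_nhds h1 (fun _ => zero_le) hBle
  simp only [controlValue_eq]
  simpa using h5.add hs

end RandomMeasure

end

theorem theorem20031705 {S Ω : Type*} [MeasurableSpace Ω] (P : Measure Ω) [IsProbabilityMeasure P]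
    {m : ℕ} (𝒮 : Set (Set S)) (h𝒮 : IsDeltaRing 𝒮) (M : Set S → Ω → RVec m)
    (hM : IsISRM P 𝒮 M) (hID : ∀ A ∈ 𝒮, IsInfDivisible (P.map (M A))) :
    (∀ A ∈ 𝒮, ∃! p : RVec m × Matrix (Fin m) (Fin m) ℝ × Measure (RVec m),
      HasLevyTriplet (P.map (M A)) p.1 p.2.1 p.2.2) ∧
    ∀ (γ : Set S → RVec m) (Q : Set S → Matrix (Fin m) (Fin m) ℝ)
      (φ : Set S → Measure (RVec m)),
      (∀ A ∈ 𝒮, HasLevyTriplet (P.map (M A)) (γ A) (Q A) (φ A)) →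
      ∃ lam : @Measure S (MeasurableSpace.generateFrom 𝒮),
        SigmaFinite lam ∧
        (∀ A ∈ 𝒮, lam A = controlValue 𝒮 γ Q φ A ∧ lam A < ∞) ∧
        (∀ lam' : @Measure S (MeasurableSpace.generateFrom 𝒮),
          (∀ A ∈ 𝒮, lam' A = controlValue 𝒮 γ Q φ A) → lam' = lam) ∧
        (∀ A : ℕ → Set S, (∀ n, A n ∈ 𝒮) →
          Tendsto (fun n => lam (A n)) atTop (𝓝 0) →
          TendstoInMeasure P (fun n => M (A n)) atTop (fun _ => 0)) ∧
        (∀ A : ℕ → Set S, (∀ n, A n ∈ 𝒮) →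
          (∀ A' : ℕ → Set S, (∀ n, A' n ∈ 𝒮) → (∀ n, A' n ⊆ A n) →
            TendstoInMeasure P (fun n => M (A' n)) atTop (fun _ => 0)) →
          Tendsto (fun n => lam (A n)) atTop (𝓝 0)) := by
  refine ⟨fun A hA => ?_, fun γ Q φ h => ?_⟩
  · have := Measure.isProbabilityMeasure_map (μ := P) (hM.measurable A hA).aemeasurable
    obtain ⟨γ, Q, φ, h⟩ := (hID A hA).exists_hasLevyTriplet
    refine ⟨(γ, Q, φ), h, fun p hp => ?_⟩
    obtain ⟨h1, h2, h3⟩ := HasLevyTriplet.unique hp h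
    exact Prod.ext h1 (Prod.ext h2 h3)
  · obtain ⟨lam, hσ, hlam, huniq⟩ := (hM.isContinuousCharge_controlValue h𝒮 h).exists_measure h𝒮
      fun A hA => hM.controlValue_lt_top h𝒮 h hA
    refine ⟨lam, hσ, fun A hA => ⟨hlam A hA, ?_⟩, huniq, fun A hA hlim => ?_, fun A hA hlim => ?_⟩
    · rw [hlam A hA]
      exact hM.controlValue_lt_top h𝒮 h hA
    · simp only [hlam _ (hA _)] at hlim
      exact hM.tendstoInMeasure_of_tendsto_controlValue h hA hlim
    · simp only [hlam _ (hA _)]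
      exact hM.tendsto_controlValue h𝒮 h hA hlim
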